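/- Let $\kappa>0$, let $u_0<u_1$ and $v_0<v_1$, and suppose that the closed characteristic rectangle $\mathcal D=[u_0,u_1]\times[v_0,v_1]$ does not meet the singular line $\{u+v=0\}$. A \emph{$W^{1,2}$ regular spacetime} in $\mathcal D$ consists of continuous functions $a,b,c,\psi:\mathcal D\to\mathbb R$ (the coefficients of the plane-symmetric metric $e^{2a}\,du\,dv-e^{2b}(e^{2c}dy^2+e^{-2c}dz^2)$ and the fluid potential) such that: 1. $b=\tfrac12\log\big(\tfrac12|u+v|\big)$; 2. $a,c,\psi$ have weak first derivatives in the interior of $\mathcal D$, and, for each $f\in\{|a_u|^{1/2},c_u,\psi_u\}$ and each $h\in\{|a_v|^{1/2},c_v,\psi_v\}$, $$\sup_{v_0\le v'\le v_1}\Big(\int_{u_0}^{u_1}|f(u',v')|^2\,du'\Big)^{1/2}<\infty,\qquad \sup_{u_0\le u'\le u_1}\Big(\int_{v_0}^{v_1}|h(u',v')|^2\,dv'\Big)^{1/2}<\infty$$ (weak derivatives being defined up to null sets, the suprema are essential suprema); 3. the reduced Einstein equations $$2(u+v)\psi_{uv}+\psi_u+\psi_v=0,\qquad 2(u+v)c_{uv}+c_u+c_v=0,$$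 $$a_u=(c_u^2+\kappa\psi_u^2)(u+v)-\tfrac14(u+v)^{-1},\qquad a_v=(c_v^2+\kappa\psi_v^2)(u+v)-\tfrac14(u+v)^{-1}$$ hold in the sense of distributions in the interior of $\mathcal D$; 4. $a(u_0,v_0)=0$. Let $\overline c,\overline\psi:[u_0,u_1]\to\mathbb R$ and $\underline c,\underline\psi:[v_0,v_1]\to\mathbb R$ be continuous functions with square-integrable weak derivatives on $(u_0,u_1)$, respectively $(v_0,v_1)$, such that $\overline c(u_0)=\underline c(v_0)$ and $\overline\psi(u_0)=\underline\psi(v_0)$. Then there exists a unique $W^{1,2}$ regular spacetime $(a,b,c,\psi)$ in $\mathcal D$ such that $$c(\cdot,v_0)=\overline c,\quad \psi(\cdot,v_0)=\overline\psi\ \text{ on }[u_0,u_1],\qquad c(u_0,\cdot)=\underline c,\quad \psi(u_0,\cdot)=\underline\psi\ \text{ on }[v_0,v_1].$$ -/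

import Mathlib

open Set MeasureTheory
open scoped ContDiff

noncomputable section

/-- The closed characteristic rectangle `[u₀, u₁] × [v₀, v₁]` in the null coordinates `(u, v)`. -/
def charRect (u₀ v₀ u₁ v₁ : ℝ) : Set (ℝ × ℝ) := Icc u₀ u₁ ×ˢ Icc v₀ v₁

/-- The interior of the characteristic rectangle. -/
def charRectInt (u₀ v₀ u₁ v₁ : ℝ) : Set (ℝ × ℝ) := Ioo u₀ u₁ ×ˢ Ioo v₀ v₁

/-- Smooth functions with compact support contained in `U`. -/
structure IsTestFunction {E : Type*} [NormedAddCommGroup E] [NormedSpace ℝ E]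
    (U : Set E) (φ : E → ℝ) : Prop where
  smooth : ContDiff ℝ ∞ φ
  compact : HasCompactSupport φ
  support_subset : tsupport φ ⊆ U

/-- Classical partial derivative in the first variable `u`. -/
def partialU (φ : ℝ × ℝ → ℝ) (p : ℝ × ℝ) : ℝ := deriv (fun x => φ (x, p.2)) p.1

/-- Classical partial derivative in the second variable `v`. -/
def partialV (φ : ℝ × ℝ → ℝ) (p : ℝ × ℝ) : ℝ := deriv (fun y => φ (p.1, y)) p.2

/-- `g` is a (Borel representative of the) weak derivative of `f` on the interval `(x₀, x₁)`. -/
structure IsWeakDeriv (x₀ x₁ : ℝ) (f g : ℝ → ℝ) : Prop where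
  measurable : Measurable g
  locallyIntegrable : LocallyIntegrableOn g (Ioo x₀ x₁)
  integral_eq : ∀ φ : ℝ → ℝ, IsTestFunction (Ioo x₀ x₁) φ →
    ∫ x in Ioo x₀ x₁, f x * deriv φ x = - ∫ x in Ioo x₀ x₁, g x * φ x

/-- `g` is a (Borel representative of the) weak partial derivative `f_u` on `U`. -/
structure IsWeakPartialU (U : Set (ℝ × ℝ)) (f g : ℝ × ℝ → ℝ) : Prop where
  measurable : Measurable g
  locallyIntegrable : LocallyIntegrableOn g U
  integral_eq : ∀ φ : ℝ × ℝ → ℝ, IsTestFunction U φ →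
    ∫ p in U, f p * partialU φ p = - ∫ p in U, g p * φ p

/-- `g` is a (Borel representative of the) weak partial derivative `f_v` on `U`. -/
structure IsWeakPartialV (U : Set (ℝ × ℝ)) (f g : ℝ × ℝ → ℝ) : Prop where
  measurable : Measurable g
  locallyIntegrable : LocallyIntegrableOn g U
  integral_eq : ∀ φ : ℝ × ℝ → ℝ, IsTestFunction U φ →
    ∫ p in U, f p * partialV φ p = - ∫ p in U, g p * φ p

/-- The `L²` norm of a function on the interval `[x₀, x₁]`. -/
def normL2 (x₀ x₁ : ℝ) (f : ℝ → ℝ) : ENNReal :=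
  (∫⁻ x in Icc x₀ x₁, ‖f x‖ₑ ^ 2) ^ (1 / 2 : ℝ)

/-- `sup_{v₀ ≤ v' ≤ v₁} (∫_{u₀}^{u₁} |f(u', v')|² du')^{1/2}`. -/
def seminormU (u₀ v₀ u₁ v₁ : ℝ) (f : ℝ × ℝ → ℝ) : ENNReal :=
  ⨆ v' ∈ Icc v₀ v₁, normL2 u₀ u₁ (fun u' => f (u', v'))

/-- `sup_{u₀ ≤ u' ≤ u₁} (∫_{v₀}^{v₁} |f(u', v')|² dv')^{1/2}`. -/
def seminormV (u₀ v₀ u₁ v₁ : ℝ) (f : ℝ × ℝ → ℝ) : ENNReal :=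
  ⨆ u' ∈ Icc u₀ u₁, normL2 v₀ v₁ (fun v' => f (u', v'))

/-- Admissible data on a null segment: a continuous function on `[x₀, x₁]` whose weak
derivative is square-integrable. -/
def IsCharData (x₀ x₁ : ℝ) (f : ℝ → ℝ) : Prop :=
  ContinuousOn f (Icc x₀ x₁) ∧ ∃ g : ℝ → ℝ, IsWeakDeriv x₀ x₁ f g ∧ normL2 x₀ x₁ g < ⊤

/-- The essential field equation `2 (u + v) f_{uv} + f_u + f_v = 0` on `U` in the sense of
distributions, `fu` and `fv` being the weak derivatives of `f`. -/
def EssentialEqDistr (U : Set (ℝ × ℝ)) (f fu fv : ℝ × ℝ → ℝ) : Prop :=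
  ∀ φ : ℝ × ℝ → ℝ, IsTestFunction U φ →
    (∫ p in U, f p * partialU (partialV (fun q => 2 * (q.1 + q.2) * φ q)) p)
      + ∫ p in U, (fu p + fv p) * φ p = 0

/-- The equation `ax = (cx² + κ ψx²) (u + v) - (1/4) (u + v)⁻¹` on `U` in the sense of
distributions. -/
def ConstraintEqDistr (κ : ℝ) (U : Set (ℝ × ℝ)) (ax cx ψx : ℝ × ℝ → ℝ) : Prop :=
  ∀ φ : ℝ × ℝ → ℝ, IsTestFunction U φ →
    ∫ p in U, ax p * φ p =
      ∫ p in U, ((cx p ^ 2 + κ * ψx p ^ 2) * (p.1 + p.2) - 1 / 4 * (p.1 + p.2)⁻¹) * φ p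

/-- `W^{1,2}` regular plane-symmetric spacetimes on `[u₀, u₁] × [v₀, v₁]`, given by the
coefficients of the metric `e^{2a} du dv - e^{2b} (e^{2c} dy² + e^{-2c} dz²)` and the fluid
potential `ψ`, and satisfying the reduced Einstein equations with constant `κ`.
Weak derivatives are defined up to null sets: the seminorms are those of some representative,
so that their suprema are essential suprema. -/
structure IsW12RegularSpacetime (κ u₀ v₀ u₁ v₁ : ℝ) (a b c ψ : ℝ × ℝ → ℝ) : Prop where
  continuousOn_a : ContinuousOn a (charRect u₀ v₀ u₁ v₁)
  continuousOn_b : ContinuousOn b (charRect u₀ v₀ u₁ v₁)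
  continuousOn_c : ContinuousOn c (charRect u₀ v₀ u₁ v₁)
  continuousOn_ψ : ContinuousOn ψ (charRect u₀ v₀ u₁ v₁)
  b_eq : ∀ p ∈ charRect u₀ v₀ u₁ v₁, b p = 1 / 2 * Real.log (1 / 2 * |p.1 + p.2|)
  weak_solution : ∃ au av cu cv ψu ψv : ℝ × ℝ → ℝ,
    IsWeakPartialU (charRectInt u₀ v₀ u₁ v₁) a au ∧
    IsWeakPartialV (charRectInt u₀ v₀ u₁ v₁) a av ∧
    IsWeakPartialU (charRectInt u₀ v₀ u₁ v₁) c cu ∧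
    IsWeakPartialV (charRectInt u₀ v₀ u₁ v₁) c cv ∧
    IsWeakPartialU (charRectInt u₀ v₀ u₁ v₁) ψ ψu ∧
    IsWeakPartialV (charRectInt u₀ v₀ u₁ v₁) ψ ψv ∧
    seminormU u₀ v₀ u₁ v₁ (fun p => √|au p|) + seminormU u₀ v₀ u₁ v₁ cu
      + seminormU u₀ v₀ u₁ v₁ ψu < ⊤ ∧
    seminormV u₀ v₀ u₁ v₁ (fun p => √|av p|) + seminormV u₀ v₀ u₁ v₁ cv
      + seminormV u₀ v₀ u₁ v₁ ψv < ⊤ ∧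
    EssentialEqDistr (charRectInt u₀ v₀ u₁ v₁) ψ ψu ψv ∧
    EssentialEqDistr (charRectInt u₀ v₀ u₁ v₁) c cu cv ∧
    ConstraintEqDistr κ (charRectInt u₀ v₀ u₁ v₁) au cu ψu ∧
    ConstraintEqDistr κ (charRectInt u₀ v₀ u₁ v₁) av cv ψv
  normalization : a (u₀, v₀) = 0

/-- The functions `c`, `ψ` take the prescribed values on the null segments `v' = v₀` (data
`cN`, `ψN`) and `u' = u₀` (data `cM`, `ψM`). -/
structure AssumesCharData (u₀ v₀ u₁ v₁ : ℝ) (cN ψN cM ψM : ℝ → ℝ) (c ψ : ℝ × ℝ → ℝ) :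
    Prop where
  c_U : ∀ u' ∈ Icc u₀ u₁, c (u', v₀) = cN u'
  ψ_U : ∀ u' ∈ Icc u₀ u₁, ψ (u', v₀) = ψN u'
  c_V : ∀ v' ∈ Icc v₀ v₁, c (u₀, v') = cM v'
  ψ_V : ∀ v' ∈ Icc v₀ v₁, ψ (u₀, v') = ψM v'

end

/-!
The essential field equation `2 (u + v) f_uv + f_u + f_v = 0` is linear and decoupled from `a`, so
the argument treats it for `f = c` and `f = ψ` separately and recovers `a` by a quadrature.

*Existence.* With `P = |u + v|^{1/2} f_u` and `Q = |u + v|^{1/2} f_v` the equation is the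
transport system `P_v = -Q / (2 (u + v))`, `Q_u = -P / (2 (u + v))`. The characteristic data
prescribe `P = P₀(u)` at `v = v₀` and `Q = Q₀(v)` at `u = u₀`, merely in `L²`, but the corrections
`P - P₀` and `Q - Q₀` are continuous and solve a Volterra system, to which the contraction principle
applies in an exponentially weighted sup norm (`exists_goursat_system`). Hence `p = f_u` and
`q = f_v` satisfy `p_v = q_u = -(p + q) / (2 (u + v))` along every characteristic segment
(`exists_isEssentialPair`), and Fubini's theorem yields a potential `f` (`exists_potential`),
continuous because `|p|` and `|q|` are dominated by functions of `u`, respectively `v`, alone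
(`continuousOn_charRect`). The constraints for `a` are compatible because the transport equations
give `∂_v (f_u² (u + v)) = -f_u f_v = ∂_u (f_v² (u + v))` (`isPrimitiveOn_sq_mul`), so the same
Fubini argument produces `a`.

*Uniqueness.* Testing the equation for a difference `f` of two solutions with
`χ(u) θ(v) / (2 (u + v))` and moving all derivatives to the test function leaves an identity that
involves the continuous function `f` only (`EssentialEqDistr.integral_tensor`). Two applications of
the du Bois-Reymond lemma, one in each variable, turn it into a homogeneous Volterra equation
(`volterra_of_integral_tensor`), whence `f = 0` (`eq_zero_of_volterra`). Then the derivatives of `c`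
and `ψ` agree almost everywhere, so the difference of two solutions `a` has vanishing
distributional gradient and is constant; it vanishes at the corner.
-/

noncomputable section

/-! ### Primitives of integrable functions on an interval -/

/-- `F` is a primitive of the integrable function `f` on `[a, b]`, i.e. `F` is absolutely
continuous there with derivative `f` almost everywhere. The values of `F` and `f` outside `[a, b]`
are irrelevant. -/
structure IsPrimitiveOn (a b : ℝ) (F f : ℝ → ℝ) : Prop where
  intervalIntegrable : IntervalIntegrable f volume a b
  eq_add : ∀ x ∈ Icc a b, F x = F a + ∫ t in a..x, f t

namespace IsPrimitiveOn

variable {a b : ℝ} {F G f g : ℝ → ℝ}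

theorem intervalIntegrable_left (h : IsPrimitiveOn a b F f) {x : ℝ} (hx : x ∈ Icc a b) :
    IntervalIntegrable f volume a x :=
  h.intervalIntegrable.mono_set (by
    rw [uIcc_of_le hx.1, uIcc_of_le (hx.1.trans hx.2)]
    exact Icc_subset_Icc_right hx.2)

theorem congr (h : IsPrimitiveOn a b F f) (hab : a ≤ b) (hF : EqOn G F (Icc a b))
    (hf : EqOn g f (Icc a b)) : IsPrimitiveOn a b G g where
  intervalIntegrable := h.intervalIntegrable.congr (fun x hx => by
    rw [uIoc_of_le hab] at hx
    exact (hf (Ioc_subset_Icc_self hx)).symm)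
  eq_add x hx := by
    rw [hF hx, hF ⟨le_rfl, hab⟩, h.eq_add x hx]
    congr 1
    refine intervalIntegral.integral_congr fun t ht => ?_
    rw [uIcc_of_le hx.1] at ht
    exact (hf ⟨ht.1, ht.2.trans hx.2⟩).symm

theorem continuousOn (h : IsPrimitiveOn a b F f) (hab : a ≤ b) : ContinuousOn F (Icc a b) := by
  have h1 := intervalIntegral.continuousOn_primitive_interval (a := a) (b := b) (μ := volume)
    (f := f) (by
      rw [uIcc_of_le hab, integrableOn_Icc_iff_integrableOn_Ioc,
        ← intervalIntegrable_iff_integrableOn_Ioc_of_le hab]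
      exact h.intervalIntegrable)
  rw [uIcc_of_le hab] at h1
  exact (continuousOn_const.add h1).congr h.eq_add

theorem add (hF : IsPrimitiveOn a b F f) (hG : IsPrimitiveOn a b G g) :
    IsPrimitiveOn a b (fun x => F x + G x) (fun x => f x + g x) where
  intervalIntegrable := hF.intervalIntegrable.add hG.intervalIntegrable
  eq_add x hx := by
    rw [intervalIntegral.integral_add (hF.intervalIntegrable_left hx)
      (hG.intervalIntegrable_left hx), hF.eq_add x hx, hG.eq_add x hx]
    ring

theorem const_mul (hF : IsPrimitiveOn a b F f) (c : ℝ) :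
    IsPrimitiveOn a b (fun x => c * F x) (fun x => c * f x) where
  intervalIntegrable := hF.intervalIntegrable.const_mul c
  eq_add x hx := by
    rw [intervalIntegral.integral_const_mul, hF.eq_add x hx]
    ring

theorem integral (hf : IntervalIntegrable f volume a b) (c : ℝ) :
    IsPrimitiveOn a b (fun x => c + ∫ t in a..x, f t) f where
  intervalIntegrable := hf
  eq_add x _ := by simp

theorem of_hasDerivAt (hd : ∀ x ∈ Icc a b, HasDerivAt F (f x) x)
    (hf : ContinuousOn f (Icc a b)) (hab : a ≤ b) : IsPrimitiveOn a b F f where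
  intervalIntegrable := ContinuousOn.intervalIntegrable (by rwa [uIcc_of_le hab])
  eq_add x hx := by
    rw [intervalIntegral.integral_eq_sub_of_hasDerivAt]
    · ring
    · intro t ht
      rw [uIcc_of_le hx.1] at ht
      exact hd t ⟨ht.1, ht.2.trans hx.2⟩
    · refine ContinuousOn.intervalIntegrable (hf.mono ?_)
      rw [uIcc_of_le hx.1]
      exact Icc_subset_Icc_right hx.2

theorem mul (hF : IsPrimitiveOn a b F f) (hG : IsPrimitiveOn a b G g) (hab : a ≤ b) :
    IsPrimitiveOn a b (fun x => F x * G x) (fun x => f x * G x + F x * g x) where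
  intervalIntegrable := by
    have hFc := hF.continuousOn hab
    have hGc := hG.continuousOn hab
    rw [← uIcc_of_le hab] at hFc hGc
    exact (hF.intervalIntegrable.mul_continuousOn hGc).add
      (hG.intervalIntegrable.continuousOn_mul hFc)
  eq_add x hx := by
    have hf := hF.intervalIntegrable_left hx
    have hg := hG.intervalIntegrable_left hx
    have key : ∀ {K k : ℝ → ℝ}, IntervalIntegrable k volume a x →
        AbsolutelyContinuousOnInterval (fun y => K a + ∫ t in a..y, k t) a x ∧
        ∀ᵐ y, y ∈ uIcc a x → deriv (fun y => K a + ∫ t in a..y, k t) y = k y := by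
      intro K k hk
      refine ⟨?_, ?_⟩
      · exact (ContDiffOn.absolutelyContinuousOnInterval contDiffOn_const).add
          (hk.absolutelyContinuousOnInterval_intervalIntegral left_mem_uIcc)
      · filter_upwards [hk.ae_hasDerivAt_integral] with y hy hyx
        exact ((hy hyx a left_mem_uIcc).const_add (K a)).deriv
    obtain ⟨hF1, hF2⟩ := key (K := F) hf
    obtain ⟨hG1, hG2⟩ := key (K := G) hg
    have hI := hF1.integral_deriv_mul_eq_sub hG1
    simp only [intervalIntegral.integral_same, add_zero] at hI
    rw [← hF.eq_add x hx, ← hG.eq_add x hx] at hI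
    have hI' : ∫ t in a..x, f t * G t + F t * g t = F x * G x - F a * G a := by
      rw [← hI]
      refine intervalIntegral.integral_congr_ae ?_
      filter_upwards [hF2, hG2] with y h1 h2 hy
      have hy' := uIoc_subset_uIcc hy
      have hyI : y ∈ Icc a b := by
        rw [uIcc_of_le hx.1] at hy'
        exact ⟨hy'.1, hy'.2.trans hx.2⟩
      rw [h1 hy', h2 hy', ← hF.eq_add y hyI, ← hG.eq_add y hyI]
    rw [hI']
    ring

end IsPrimitiveOn

/-! ### Test functions and the du Bois-Reymond lemma -/

section TestFunctions

variable {a b : ℝ} {χ : ℝ → ℝ}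

theorem IsTestFunction.eq_zero {E : Type*} [NormedAddCommGroup E] [NormedSpace ℝ E]
    {U : Set E} {φ : E → ℝ} (h : IsTestFunction U φ) {x : E} (hx : x ∉ U) : φ x = 0 :=
  image_eq_zero_of_notMem_tsupport fun h' => hx (h.support_subset h')

theorem IsTestFunction.isPrimitiveOn (h : IsTestFunction (Ioo a b) χ) (hab : a ≤ b) :
    IsPrimitiveOn a b χ (deriv χ) :=
  .of_hasDerivAt
    (fun x _ => (h.smooth.differentiable (by simp) x).hasDerivAt)
    (h.smooth.continuous_deriv (by simp)).continuousOn hab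

/-- Integration by parts of a primitive against a test function. -/
theorem IsPrimitiveOn.integral_mul_deriv {F f : ℝ → ℝ} (hF : IsPrimitiveOn a b F f)
    (hχ : IsTestFunction (Ioo a b) χ) (hab : a ≤ b) :
    ∫ x in Ioo a b, F x * deriv χ x = - ∫ x in Ioo a b, f x * χ x := by
  have h := (hF.mul (hχ.isPrimitiveOn hab) hab).eq_add b ⟨hab, le_rfl⟩
  have hFc := hF.continuousOn hab
  rw [← uIcc_of_le hab] at hFc
  have h1 := hF.intervalIntegrable.mul_continuousOn hχ.smooth.continuous.continuousOn
  have h2 := (hχ.isPrimitiveOn hab).intervalIntegrable.continuousOn_mul hFc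
  rw [intervalIntegral.integral_add h1 h2, hχ.eq_zero (x := a) (by simp),
    hχ.eq_zero (x := b) (by simp)] at h
  simp only [intervalIntegral.integral_of_le hab, integral_Ioc_eq_integral_Ioo] at h
  linarith

/-- A test function with vanishing integral is the derivative of a test function. -/
theorem IsTestFunction.exists_deriv_eq {φ : ℝ → ℝ} (hφ : IsTestFunction (Ioo a b) φ)
    (h0 : ∫ x in Ioo a b, φ x = 0) :
    ∃ χ, IsTestFunction (Ioo a b) χ ∧ deriv χ = φ := by
  rcases lt_or_ge a b with hab | hab
  swap
  · refine ⟨0, ⟨contDiff_const, HasCompactSupport.zero, by simp [tsupport]⟩, ?_⟩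
    funext x
    rw [hφ.eq_zero (x := x) (by simp [Ioo_eq_empty (not_lt.2 hab)])]
    simp
  -- the support of `φ` lies in a compact subinterval
  obtain ⟨a', b', ha', hb', hs⟩ : ∃ a' b', a < a' ∧ b' < b ∧ tsupport φ ⊆ Icc a' b' := by
    rcases (tsupport φ).eq_empty_or_nonempty with he | hne
    · exact ⟨b, a, hab, hab, by simp [he]⟩
    · obtain ⟨x, hx, hx'⟩ := hφ.compact.isCompact.exists_isLeast hne
      obtain ⟨y, hy, hy'⟩ := hφ.compact.isCompact.exists_isGreatest hne
      exact ⟨x, y, (hφ.support_subset hx).1, (hφ.support_subset hy).2,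
        fun z hz => ⟨hx' hz, hy' hz⟩⟩
  have hc := hφ.smooth.continuous
  have hz : ∀ x, x ∉ Icc a' b' → φ x = 0 := fun x hx =>
    image_eq_zero_of_notMem_tsupport fun h => hx (hs h)
  have hd : ∀ x, HasDerivAt (fun x => ∫ t in a..x, φ t) (φ x) x := fun x =>
    intervalIntegral.integral_hasDerivAt_right (hc.intervalIntegrable _ _)
      (hc.stronglyMeasurableAtFilter _ _) hc.continuousAt
  have hderiv : deriv (fun x => ∫ t in a..x, φ t) = φ := funext fun x => (hd x).deriv
  have hsub : Function.support (fun x => ∫ t in a..x, φ t) ⊆ Icc a' b' := by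
    intro x hx
    by_contra hx'
    refine hx ?_
    rw [mem_Icc, not_and_or, not_le, not_le] at hx'
    rcases hx' with hx' | hx'
    · refine (intervalIntegral.integral_congr (g := fun _ => 0) fun t ht => ?_).trans (by simp)
      refine hz t fun h => ?_
      have := ht.2
      have h3 : max a x < a' := max_lt ha' hx'
      linarith [h.1]
    · have h1 : ∫ t in a..b, φ t = 0 := by
        rw [intervalIntegral.integral_of_le hab.le, integral_Ioc_eq_integral_Ioo, h0]
      have h2 : ∫ t in b..x, φ t = 0 := by
        refine (intervalIntegral.integral_congr (g := fun _ => 0) fun t ht => ?_).trans (by simp)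
        refine hz t fun h => ?_
        have := ht.1
        have h3 : b' < min b x := lt_min hb' hx'
        linarith [h.2]
      change ∫ t in a..x, φ t = 0
      rw [← intervalIntegral.integral_add_adjacent_intervals (hc.intervalIntegrable a b)
        (hc.intervalIntegrable b x), h1, h2, add_zero]
  refine ⟨_, ⟨?_, ?_, ?_⟩, hderiv⟩
  · rw [contDiff_infty_iff_deriv, hderiv]
    exact ⟨fun x => (hd x).differentiableAt, hφ.smooth⟩
  · exact HasCompactSupport.of_support_subset_isCompact isCompact_Icc hsub
  · exact (closure_minimal hsub isClosed_Icc).trans (Icc_subset_Ioo ha' hb')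

theorem exists_isTestFunction_integral_eq_one (hab : a < b) :
    ∃ η, IsTestFunction (Ioo a b) η ∧ ∫ x in Ioo a b, η x = 1 := by
  let B : ContDiffBump ((a + b) / 2) := ⟨(b - a) / 8, (b - a) / 4, by linarith, by linarith⟩
  have hs : tsupport (B.normed volume) ⊆ Ioo a b := by
    rw [B.tsupport_normed_eq, Real.closedBall_eq_Icc]
    refine Icc_subset_Ioo ?_ ?_ <;> simp only [B] <;> linarith
  refine ⟨B.normed volume, ⟨B.contDiff_normed, B.hasCompactSupport_normed, hs⟩, ?_⟩
  rw [setIntegral_eq_integral_of_forall_compl_eq_zero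
    (fun x hx => image_eq_zero_of_notMem_tsupport fun h => hx (hs h)), B.integral_normed]

theorem IsTestFunction.integrableOn_mul {E : Type*} [NormedAddCommGroup E] [NormedSpace ℝ E]
    [MeasurableSpace E] [BorelSpace E] {μ : Measure E}
    {U : Set E} {φ : E → ℝ} (h : IsTestFunction U φ) {V : Set E} {f : E → ℝ}
    (hf : IntegrableOn f V μ) : IntegrableOn (fun x => f x * φ x) V μ := by
  obtain ⟨C, hC⟩ := h.compact.exists_bound_of_continuous h.smooth.continuous
  exact hf.mul_bdd (c := C) h.smooth.continuous.aestronglyMeasurable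
    (Filter.Eventually.of_forall hC)

/-- The fundamental lemma of du Bois-Reymond: a continuous function with vanishing weak derivative
is constant. -/
theorem eq_const_of_integral_mul_deriv_eq_zero {D : ℝ → ℝ} (hab : a < b)
    (hD : ContinuousOn D (Icc a b))
    (h : ∀ χ, IsTestFunction (Ioo a b) χ → ∫ x in Ioo a b, D x * deriv χ x = 0) :
    ∀ x ∈ Icc a b, D x = D a := by
  obtain ⟨η, hη, hη1⟩ := exists_isTestFunction_integral_eq_one hab
  have hDi : IntegrableOn D (Ioo a b) :=
    (hD.integrableOn_compact isCompact_Icc).mono_set Ioo_subset_Icc_self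
  have hone : IntegrableOn (fun _ : ℝ => (1 : ℝ)) (Ioo a b) := by simp
  have hi : ∀ {φ : ℝ → ℝ}, IsTestFunction (Ioo a b) φ → IntegrableOn φ (Ioo a b) := by
    intro φ hφ
    simpa using hφ.integrableOn_mul hone
  -- subtracting multiples of `η` produces test functions of vanishing integral
  set c := ∫ x in Ioo a b, D x * η x with hc
  have hae : ∀ᵐ x, x ∈ Ioo a b → D x - c = 0 := by
    refine isOpen_Ioo.ae_eq_zero_of_integral_contDiff_smul_eq_zero
      (hDi.sub (show IntegrableOn (fun _ => c) (Ioo a b) volume by simp)).locallyIntegrableOn ?_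
    intro φ hφ1 hφ2 hφ3
    have hφ : IsTestFunction (Ioo a b) φ := ⟨hφ1, hφ2, hφ3⟩
    set m := ∫ x in Ioo a b, φ x with hm
    have hψ : IsTestFunction (Ioo a b) (fun x => φ x - m * η x) := by
      refine ⟨hφ1.sub (contDiff_const.mul hη.smooth), ?_, ?_⟩
      · exact hφ2.sub hη.compact.mul_left
      · refine (tsupport_sub _ _).trans (union_subset hφ3 ?_)
        exact (tsupport_mul_subset_right).trans hη.support_subset
    obtain ⟨χ, hχ, hχd⟩ := hψ.exists_deriv_eq (by
      rw [integral_sub (hi hφ) ((hi hη).const_mul m), integral_const_mul, hη1, ← hm]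
      ring)
    have h0 := h χ hχ
    rw [hχd] at h0
    have e1 : ∫ x in Ioo a b, D x * (φ x - m * η x)
        = (∫ x in Ioo a b, D x * φ x) - m * c := by
      rw [hc, ← integral_const_mul, ← integral_sub (hφ.integrableOn_mul hDi)
        ((hη.integrableOn_mul hDi).const_mul m)]
      congr 1
      funext x
      ring
    have e2 : ∫ x in Ioo a b, φ x • (D x - c) = (∫ x in Ioo a b, D x * φ x) - c * m := by
      rw [hm, ← integral_const_mul, ← integral_sub (hφ.integrableOn_mul hDi)
        ((hi hφ).const_mul c)]
      congr 1
      funext x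
      simp only [smul_eq_mul]
      ring
    rw [← setIntegral_eq_integral_of_forall_compl_eq_zero (s := Ioo a b)
      (fun x hx => by simp [hφ.eq_zero hx]), e2]
    linarith
  have hEq : EqOn D (fun _ => c) (Ioo a b) := by
    refine Measure.eqOn_open_of_ae_eq (μ := volume) ?_ isOpen_Ioo
      (hD.mono Ioo_subset_Icc_self) continuousOn_const
    rw [Filter.EventuallyEq, ae_restrict_iff' measurableSet_Ioo]
    filter_upwards [hae] with x hx hx'
    linarith [hx hx']
  have hEq' : EqOn D (fun _ => c) (Icc a b) :=
    hEq.of_subset_closure hD continuousOn_const Ioo_subset_Icc_self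
      (by rw [closure_Ioo hab.ne])
  intro x hx
  rw [hEq' hx, hEq' ⟨le_rfl, hab.le⟩]

/-- A continuous function with an integrable weak derivative is a primitive of it. -/
theorem isPrimitiveOn_of_integral_mul_deriv {A B : ℝ → ℝ} (hab : a < b)
    (hA : ContinuousOn A (Icc a b)) (hB : IntervalIntegrable B volume a b)
    (h : ∀ χ, IsTestFunction (Ioo a b) χ →
      ∫ x in Ioo a b, A x * deriv χ x = - ∫ x in Ioo a b, B x * χ x) :
    IsPrimitiveOn a b A B where
  intervalIntegrable := hB
  eq_add x hx := by
    have hG := IsPrimitiveOn.integral hB 0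
    have hGc := hG.continuousOn hab.le
    have key := eq_const_of_integral_mul_deriv_eq_zero hab (hA.sub hGc) (fun χ hχ => by
      have hχc := (hχ.smooth.continuous_deriv (by simp)).continuousOn (s := Icc a b)
      have e1 := ((hA.mul hχc).integrableOn_compact (μ := volume) isCompact_Icc).mono_set
        Ioo_subset_Icc_self
      have e2 := ((hGc.mul hχc).integrableOn_compact (μ := volume) isCompact_Icc).mono_set
        Ioo_subset_Icc_self
      simp only [Pi.sub_apply, sub_mul]
      refine (integral_sub e1 e2).trans ?_
      simp only [Pi.mul_apply]
      rw [ h χ hχ, hG.integral_mul_deriv hχ hab.le]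
      ring) x hx
    simp only [Pi.sub_apply, intervalIntegral.integral_same] at key
    linarith

end TestFunctions

/-! ### Test functions of two variables -/

section TestFunctions

variable {u₀ v₀ u₁ v₁ : ℝ} {φ : ℝ × ℝ → ℝ}

theorem hasDerivAt_slice_left (hφ : Differentiable ℝ φ) (p : ℝ × ℝ) :
    HasDerivAt (fun x => φ (x, p.2)) (fderiv ℝ φ p (1, 0)) p.1 :=
  HasFDerivAt.comp_hasDerivAt (f := fun x => (x, p.2)) p.1 (hφ p).hasFDerivAt
    ((hasDerivAt_id p.1).prodMk (hasDerivAt_const p.1 p.2))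

theorem hasDerivAt_slice_right (hφ : Differentiable ℝ φ) (p : ℝ × ℝ) :
    HasDerivAt (fun y => φ (p.1, y)) (fderiv ℝ φ p (0, 1)) p.2 :=
  HasFDerivAt.comp_hasDerivAt (f := fun y => (p.1, y)) p.2 (hφ p).hasFDerivAt
    ((hasDerivAt_const p.2 p.1).prodMk (hasDerivAt_id p.2))

theorem partialU_eq_fderiv (hφ : Differentiable ℝ φ) :
    partialU φ = fun p => fderiv ℝ φ p (1, 0) :=
  funext fun p => (hasDerivAt_slice_left hφ p).deriv

theorem partialV_eq_fderiv (hφ : Differentiable ℝ φ) :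
    partialV φ = fun p => fderiv ℝ φ p (0, 1) :=
  funext fun p => (hasDerivAt_slice_right hφ p).deriv

theorem IsTestFunction.fderiv_apply {E : Type*} [NormedAddCommGroup E] [NormedSpace ℝ E]
    {U : Set E} {φ : E → ℝ} (h : IsTestFunction U φ) (w : E) :
    IsTestFunction U (fun p => fderiv ℝ φ p w) where
  smooth := (h.smooth.fderiv_right (m := ∞) (by simp)).clm_apply contDiff_const
  compact := h.compact.fderiv_apply ℝ w
  support_subset := (tsupport_fderiv_apply_subset ℝ w).trans h.support_subset

theorem IsTestFunction.partialU {U : Set (ℝ × ℝ)} (h : IsTestFunction U φ) :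
    IsTestFunction U (partialU φ) := by
  rw [partialU_eq_fderiv (h.smooth.differentiable (by simp))]
  exact h.fderiv_apply _

theorem IsTestFunction.partialV {U : Set (ℝ × ℝ)} (h : IsTestFunction U φ) :
    IsTestFunction U (partialV φ) := by
  rw [partialV_eq_fderiv (h.smooth.differentiable (by simp))]
  exact h.fderiv_apply _

theorem IsTestFunction.slice_left (h : IsTestFunction (charRectInt u₀ v₀ u₁ v₁) φ) (v : ℝ) :
    IsTestFunction (Ioo u₀ u₁) (fun u => φ (u, v)) := by
  have hs : tsupport (fun u => φ (u, v)) ⊆ (fun u => (u, v)) ⁻¹' tsupport φ :=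
    tsupport_comp_subset_preimage φ (f := fun u => (u, v)) (by fun_prop)
  refine ⟨h.smooth.comp (by fun_prop), ?_, fun x hx => (h.support_subset (hs hx)).1⟩
  exact (h.compact.isCompact.image continuous_fst).of_isClosed_subset (isClosed_tsupport _)
    fun x hx => ⟨(x, v), hs hx, rfl⟩

theorem IsTestFunction.slice_right (h : IsTestFunction (charRectInt u₀ v₀ u₁ v₁) φ) (u : ℝ) :
    IsTestFunction (Ioo v₀ v₁) (fun v => φ (u, v)) := by
  have hs : tsupport (fun v => φ (u, v)) ⊆ (fun v => (u, v)) ⁻¹' tsupport φ :=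
    tsupport_comp_subset_preimage φ (f := fun v => (u, v)) (by fun_prop)
  refine ⟨h.smooth.comp (by fun_prop), ?_, fun x hx => (h.support_subset (hs hx)).2⟩
  exact (h.compact.isCompact.image continuous_snd).of_isClosed_subset (isClosed_tsupport _)
    fun x hx => ⟨(u, x), hs hx, rfl⟩

end TestFunctions

/-! ### Potentials on a characteristic rectangle -/

section Rectangle

variable {u₀ v₀ u₁ v₁ : ℝ}

theorem isOpen_charRectInt : IsOpen (charRectInt u₀ v₀ u₁ v₁) := isOpen_Ioo.prod isOpen_Ioo

theorem isCompact_charRect : IsCompact (charRect u₀ v₀ u₁ v₁) := isCompact_Icc.prod isCompact_Icc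

theorem charRectInt_subset : charRectInt u₀ v₀ u₁ v₁ ⊆ charRect u₀ v₀ u₁ v₁ :=
  prod_mono Ioo_subset_Icc_self Ioo_subset_Icc_self

theorem measurableSet_charRect : MeasurableSet (charRect u₀ v₀ u₁ v₁) :=
  measurableSet_Icc.prod measurableSet_Icc

theorem setIntegral_charRectInt {f : ℝ × ℝ → ℝ} (hf : IntegrableOn f (charRectInt u₀ v₀ u₁ v₁)) :
    ∫ p in charRectInt u₀ v₀ u₁ v₁, f p = ∫ u in Ioo u₀ u₁, ∫ v in Ioo v₀ v₁, f (u, v) :=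
  setIntegral_prod f hf

theorem setIntegral_charRectInt_symm {f : ℝ × ℝ → ℝ}
    (hf : IntegrableOn f (charRectInt u₀ v₀ u₁ v₁)) :
    ∫ p in charRectInt u₀ v₀ u₁ v₁, f p = ∫ v in Ioo v₀ v₁, ∫ u in Ioo u₀ u₁, f (u, v) := by
  rw [charRectInt, Measure.volume_eq_prod, IntegrableOn, ← Measure.prod_restrict] at hf
  rw [charRectInt, Measure.volume_eq_prod, ← Measure.prod_restrict, integral_prod_symm _ hf]

/-- A function whose slices in `u` are primitives has the expected weak derivative in `u`. -/
theorem setIntegral_mul_partialU {F p φ : ℝ × ℝ → ℝ} (hu : u₀ ≤ u₁)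
    (hF : IntegrableOn F (charRectInt u₀ v₀ u₁ v₁)) (hp : IntegrableOn p (charRectInt u₀ v₀ u₁ v₁))
    (h : ∀ v ∈ Icc v₀ v₁, IsPrimitiveOn u₀ u₁ (fun u => F (u, v)) (fun u => p (u, v)))
    (hφ : IsTestFunction (charRectInt u₀ v₀ u₁ v₁) φ) :
    ∫ z in charRectInt u₀ v₀ u₁ v₁, F z * partialU φ z =
      - ∫ z in charRectInt u₀ v₀ u₁ v₁, p z * φ z := by
  rw [setIntegral_charRectInt_symm (hφ.partialU.integrableOn_mul hF),
    setIntegral_charRectInt_symm (hφ.integrableOn_mul hp), ← integral_neg]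
  refine setIntegral_congr_fun measurableSet_Ioo fun v hv => ?_
  exact (h v (Ioo_subset_Icc_self hv)).integral_mul_deriv (hφ.slice_left v) hu

/-- A function whose slices in `v` are primitives has the expected weak derivative in `v`. -/
theorem setIntegral_mul_partialV {F q φ : ℝ × ℝ → ℝ} (hv : v₀ ≤ v₁)
    (hF : IntegrableOn F (charRectInt u₀ v₀ u₁ v₁)) (hq : IntegrableOn q (charRectInt u₀ v₀ u₁ v₁))
    (h : ∀ u ∈ Icc u₀ u₁, IsPrimitiveOn v₀ v₁ (fun v => F (u, v)) (fun v => q (u, v)))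
    (hφ : IsTestFunction (charRectInt u₀ v₀ u₁ v₁) φ) :
    ∫ z in charRectInt u₀ v₀ u₁ v₁, F z * partialV φ z =
      - ∫ z in charRectInt u₀ v₀ u₁ v₁, q z * φ z := by
  rw [setIntegral_charRectInt (hφ.partialV.integrableOn_mul hF),
    setIntegral_charRectInt (hφ.integrableOn_mul hq), ← integral_neg]
  refine setIntegral_congr_fun measurableSet_Ioo fun u hu => ?_
  exact (h u (Ioo_subset_Icc_self hu)).integral_mul_deriv (hφ.slice_right u) hv

theorem IsPrimitiveOn.abs_sub_le {a b : ℝ} {F f M m : ℝ → ℝ} (hF : IsPrimitiveOn a b F f)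
    (hM : IsPrimitiveOn a b M m) (hab : a ≤ b) (h : ∀ x ∈ Icc a b, |f x| ≤ m x) {x y : ℝ}
    (hx : x ∈ Icc a b) (hy : y ∈ Icc a b) : |F x - F y| ≤ |M x - M y| := by
  have key : ∀ {G g : ℝ → ℝ}, IsPrimitiveOn a b G g → G x - G y = ∫ t in y..x, g t := by
    intro G g hG
    rw [hG.eq_add x hx, hG.eq_add y hy, ← intervalIntegral.integral_interval_sub_left
      (hG.intervalIntegrable_left hx) (hG.intervalIntegrable_left hy)]
    ring
  have hsub : uIcc y x ⊆ Icc a b := by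
    rw [← uIcc_of_le hab] at hx hy ⊢
    exact uIcc_subset_uIcc hy hx
  rw [key hF, key hM]
  have hmi : IntervalIntegrable m volume y x :=
    hM.intervalIntegrable.mono_set (by rwa [uIcc_of_le hab])
  refine intervalIntegral.norm_integral_le_abs_of_norm_le (f := f) ?_ hmi
  rw [ae_restrict_iff' measurableSet_uIoc]
  exact Filter.Eventually.of_forall fun t ht => h t (hsub (uIoc_subset_uIcc ht))

theorem intervalIntegrable_of_integrableOn_Icc {a b : ℝ} {m : ℝ → ℝ} (hab : a ≤ b)
    (hm : IntegrableOn m (Icc a b)) : IntervalIntegrable m volume a b :=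
  (intervalIntegrable_iff_integrableOn_Icc_of_le hab).2 hm

/-- If all slices of `F` are primitives whose densities `p`, `q` are dominated, uniformly in the
remaining variable, by integrable functions, then `F` is jointly continuous. -/
theorem continuousOn_charRect {F p q : ℝ × ℝ → ℝ} {m n : ℝ → ℝ} (hu : u₀ ≤ u₁) (hv : v₀ ≤ v₁)
    (hFu : ∀ v ∈ Icc v₀ v₁, IsPrimitiveOn u₀ u₁ (fun u => F (u, v)) (fun u => p (u, v)))
    (hFv : ∀ u ∈ Icc u₀ u₁, IsPrimitiveOn v₀ v₁ (fun v => F (u, v)) (fun v => q (u, v)))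
    (hm : IntegrableOn m (Icc u₀ u₁)) (hn : IntegrableOn n (Icc v₀ v₁))
    (hpm : ∀ z ∈ charRect u₀ v₀ u₁ v₁, |p z| ≤ m z.1)
    (hqn : ∀ z ∈ charRect u₀ v₀ u₁ v₁, |q z| ≤ n z.2) :
    ContinuousOn F (charRect u₀ v₀ u₁ v₁) := by
  have hM := IsPrimitiveOn.integral (intervalIntegrable_of_integrableOn_Icc hu hm) 0
  have hN := IsPrimitiveOn.integral (intervalIntegrable_of_integrableOn_Icc hv hn) 0
  set M := fun x => (0 : ℝ) + ∫ t in u₀..x, m t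
  set N := fun x => (0 : ℝ) + ∫ t in v₀..x, n t
  intro w hw
  have hle : ∀ z ∈ charRect u₀ v₀ u₁ v₁,
      dist (F z) (F w) ≤ |M z.1 - M w.1| + |N z.2 - N w.2| := by
    intro z hz
    have h1 := (hFu z.2 hz.2).abs_sub_le hM hu (fun x hx => hpm (x, z.2) ⟨hx, hz.2⟩) hz.1 hw.1
    have h2 := (hFv w.1 hw.1).abs_sub_le hN hv (fun x hx => hqn (w.1, x) ⟨hw.1, hx⟩) hz.2 hw.2
    rw [Real.dist_eq]
    exact (abs_sub_le (F z) (F (w.1, z.2)) (F w)).trans (add_le_add h1 h2)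
  have hMc : ContinuousOn (fun z : ℝ × ℝ => M z.1) (charRect u₀ v₀ u₁ v₁) :=
    (hM.continuousOn hu).comp continuousOn_fst fun z hz => hz.1
  have hNc : ContinuousOn (fun z : ℝ × ℝ => N z.2) (charRect u₀ v₀ u₁ v₁) :=
    (hN.continuousOn hv).comp continuousOn_snd fun z hz => hz.2
  have hlim : ContinuousOn (fun z : ℝ × ℝ => |M z.1 - M w.1| + |N z.2 - N w.2|)
      (charRect u₀ v₀ u₁ v₁) :=
    ((hMc.sub continuousOn_const).abs).add ((hNc.sub continuousOn_const).abs)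
  have h0 := hlim w hw
  simp only [ContinuousWithinAt, sub_self, abs_zero, add_zero] at h0
  refine tendsto_iff_dist_tendsto_zero.2 (squeeze_zero' (Filter.Eventually.of_forall
    fun _ => dist_nonneg) ?_ h0)
  filter_upwards [self_mem_nhdsWithin] with z hz using hle z hz

theorem integrableOn_charRect_of_abs_le_left {p : ℝ × ℝ → ℝ} {m : ℝ → ℝ} (hp : Measurable p)
    (hm : IntegrableOn m (Icc u₀ u₁)) (hpm : ∀ z ∈ charRect u₀ v₀ u₁ v₁, |p z| ≤ m z.1) :
    IntegrableOn p (charRect u₀ v₀ u₁ v₁) := by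
  have h1 := Integrable.comp_fst hm (volume.restrict (Icc v₀ v₁))
  rw [Measure.prod_restrict, ← Measure.volume_eq_prod] at h1
  refine Integrable.mono' h1 hp.aestronglyMeasurable ?_
  exact (ae_restrict_iff' measurableSet_charRect).2 (Filter.Eventually.of_forall hpm)

theorem integrableOn_charRect_of_abs_le_right {q : ℝ × ℝ → ℝ} {n : ℝ → ℝ} (hq : Measurable q)
    (hn : IntegrableOn n (Icc v₀ v₁)) (hqn : ∀ z ∈ charRect u₀ v₀ u₁ v₁, |q z| ≤ n z.2) :
    IntegrableOn q (charRect u₀ v₀ u₁ v₁) := by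
  have h1 := Integrable.comp_snd hn (volume.restrict (Icc u₀ u₁))
  rw [Measure.prod_restrict, ← Measure.volume_eq_prod] at h1
  refine Integrable.mono' h1 hq.aestronglyMeasurable ?_
  exact (ae_restrict_iff' measurableSet_charRect).2 (Filter.Eventually.of_forall hqn)

theorem normL2_le {a b : ℝ} {f n : ℝ → ℝ} (h : ∀ x ∈ Icc a b, f x ^ 2 ≤ n x) :
    normL2 a b f ≤ (∫⁻ x in Icc a b, ENNReal.ofReal (n x)) ^ (1 / 2 : ℝ) := by
  refine ENNReal.rpow_le_rpow (setLIntegral_mono' measurableSet_Icc fun x hx => ?_) (by norm_num)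
  rw [Real.enorm_eq_ofReal_abs, ← ENNReal.ofReal_pow (abs_nonneg _), sq_abs]
  exact ENNReal.ofReal_le_ofReal (h x hx)

theorem lintegral_ofReal_rpow_lt_top {a b : ℝ} {n : ℝ → ℝ} (hn : IntegrableOn n (Icc a b)) :
    (∫⁻ x in Icc a b, ENNReal.ofReal (n x)) ^ (1 / 2 : ℝ) < ⊤ :=
  ENNReal.rpow_lt_top_of_nonneg (by norm_num) hn.lintegral_lt_top.ne

theorem seminormU_lt_top {f : ℝ × ℝ → ℝ} {n : ℝ → ℝ} (hn : IntegrableOn n (Icc u₀ u₁))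
    (h : ∀ z ∈ charRect u₀ v₀ u₁ v₁, f z ^ 2 ≤ n z.1) : seminormU u₀ v₀ u₁ v₁ f < ⊤ :=
  (iSup₂_le fun v hv => normL2_le fun x hx => h (x, v) ⟨hx, hv⟩).trans_lt
    (lintegral_ofReal_rpow_lt_top hn)

theorem seminormV_lt_top {f : ℝ × ℝ → ℝ} {n : ℝ → ℝ} (hn : IntegrableOn n (Icc v₀ v₁))
    (h : ∀ z ∈ charRect u₀ v₀ u₁ v₁, f z ^ 2 ≤ n z.2) : seminormV u₀ v₀ u₁ v₁ f < ⊤ :=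
  (iSup₂_le fun u hu => normL2_le fun x hx => h (u, x) ⟨hu, hx⟩).trans_lt
    (lintegral_ofReal_rpow_lt_top hn)

/-- The compatibility condition `p_v = g = q_u` makes `p du + q dv` exact: integrating it along
either pair of sides of a rectangle gives the same potential `F`, by Fubini's theorem. -/
theorem exists_potential {p q g : ℝ × ℝ → ℝ} (hu : u₀ ≤ u₁) (hv : v₀ ≤ v₁)
    (hp : ∀ v ∈ Icc v₀ v₁, IntervalIntegrable (fun u => p (u, v)) volume u₀ u₁)
    (hq : ∀ u ∈ Icc u₀ u₁, IntervalIntegrable (fun v => q (u, v)) volume v₀ v₁)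
    (hg : IntegrableOn g (charRect u₀ v₀ u₁ v₁))
    (hpg : ∀ u ∈ Icc u₀ u₁, IsPrimitiveOn v₀ v₁ (fun v => p (u, v)) (fun v => g (u, v)))
    (hqg : ∀ v ∈ Icc v₀ v₁, IsPrimitiveOn u₀ u₁ (fun u => q (u, v)) (fun u => g (u, v)))
    (c : ℝ) :
    ∃ F : ℝ × ℝ → ℝ, F (u₀, v₀) = c ∧
      (∀ v ∈ Icc v₀ v₁, IsPrimitiveOn u₀ u₁ (fun u => F (u, v)) (fun u => p (u, v))) ∧
      (∀ u ∈ Icc u₀ u₁, IsPrimitiveOn v₀ v₁ (fun v => F (u, v)) (fun v => q (u, v))) := by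
  have hu0 : u₀ ∈ Icc u₀ u₁ := ⟨le_rfl, hu⟩
  have hv0 : v₀ ∈ Icc v₀ v₁ := ⟨le_rfl, hv⟩
  let F : ℝ × ℝ → ℝ := fun z => c + (∫ y in v₀..z.2, q (u₀, y)) + ∫ x in u₀..z.1, p (x, z.2)
  have hF : ∀ u ∈ Icc u₀ u₁, ∀ v ∈ Icc v₀ v₁,
      F (u, v) = c + (∫ x in u₀..u, p (x, v₀)) + ∫ y in v₀..v, q (u, y) := by
    intro u hu' v hv'
    have sub : ∀ {a b x : ℝ} {h : ℝ → ℝ}, x ∈ Icc a b → IntervalIntegrable h volume a b →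
        IntervalIntegrable h volume a x := by
      intro a b x h hx hh
      refine hh.mono_set ?_
      rw [uIcc_of_le hx.1, uIcc_of_le (hx.1.trans hx.2)]
      exact Icc_subset_Icc_right hx.2
    have hswap : ∫ x in u₀..u, ∫ y in v₀..v, g (x, y) = ∫ y in v₀..v, ∫ x in u₀..u, g (x, y) := by
      refine intervalIntegral_intervalIntegral_swap (F := fun x y => g (x, y))
        (hg.mono_set ?_)
      rw [uIoc_of_le hu'.1, uIoc_of_le hv'.1]
      exact prod_mono (Ioc_subset_Icc_self.trans (Icc_subset_Icc_right hu'.2))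
        (Ioc_subset_Icc_self.trans (Icc_subset_Icc_right hv'.2))
    have e1 : ∫ x in u₀..u, ∫ y in v₀..v, g (x, y)
        = (∫ x in u₀..u, p (x, v)) - ∫ x in u₀..u, p (x, v₀) := by
      rw [← intervalIntegral.integral_sub (sub hu' (hp v hv')) (sub hu' (hp v₀ hv0))]
      refine intervalIntegral.integral_congr fun x hx => ?_
      rw [uIcc_of_le hu'.1] at hx
      have := (hpg x ⟨hx.1, hx.2.trans hu'.2⟩).eq_add v hv'
      simp only [this]
      ring
    have e2 : ∫ y in v₀..v, ∫ x in u₀..u, g (x, y)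
        = (∫ y in v₀..v, q (u, y)) - ∫ y in v₀..v, q (u₀, y) := by
      rw [← intervalIntegral.integral_sub (sub hv' (hq u hu')) (sub hv' (hq u₀ hu0))]
      refine intervalIntegral.integral_congr fun y hy => ?_
      rw [uIcc_of_le hv'.1] at hy
      have := (hqg y ⟨hy.1, hy.2.trans hv'.2⟩).eq_add u hu'
      simp only [this]
      ring
    simp only [F]
    linarith
  refine ⟨F, by simp [F], fun v hv' => ⟨hp v hv', fun u _ => ?_⟩,
    fun u hu' => ⟨hq u hu', fun v hv' => ?_⟩⟩
  · simp only [F, intervalIntegral.integral_same, add_zero]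
  · rw [hF u hu' v hv', hF u hu' v₀ hv0]
    simp

end Rectangle

/-! ### Volterra systems -/

section Volterra

theorem continuous_integral_mul {X : Type*} [TopologicalSpace X] [CompactSpace X]
    [FirstCountableTopology X] {c d : ℝ} (hcd : c ≤ d) (h : C(X × Icc c d, ℝ)) {w : ℝ → ℝ}
    (hw : IntervalIntegrable w volume c d) {b : X → Icc c d} (hb : Continuous b) :
    Continuous fun x => ∫ y in c..b x, h (x, projIcc c d hcd y) * w y := by
  have hw' : IntegrableOn w (Ioc c d) := (intervalIntegrable_iff_integrableOn_Ioc_of_le hcd).1 hw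
  have hcont : ∀ y, Continuous fun x => h (x, projIcc c d hcd y) := fun y => by fun_prop
  have hmeas : ∀ x, Continuous fun y => h (x, projIcc c d hcd y) := fun x =>
    h.continuous.comp (continuous_const.prodMk continuous_projIcc)
  have heq : ∀ x, ∫ y in c..b x, h (x, projIcc c d hcd y) * w y
      = ∫ y in Ioc c d, (Iic (b x : ℝ)).indicator (fun y => h (x, projIcc c d hcd y) * w y) y := by
    intro x
    rw [intervalIntegral.integral_of_le (b x).2.1, setIntegral_indicator measurableSet_Iic,
      Ioc_inter_Iic, min_eq_right (b x).2.2]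
  simp_rw [heq]
  rw [continuous_iff_continuousAt]
  intro x₀
  refine continuousAt_of_dominated (bound := fun y => ‖h‖ * ‖w y‖) ?_ ?_
    (hw'.norm.const_mul _) ?_
  · refine Filter.Eventually.of_forall fun x => ?_
    exact ((hmeas x).aestronglyMeasurable.mul hw'.aestronglyMeasurable).indicator measurableSet_Iic
  · refine Filter.Eventually.of_forall fun x => Filter.Eventually.of_forall fun y => ?_
    refine (norm_indicator_le_norm_self _ _).trans ?_
    rw [norm_mul]
    exact mul_le_mul_of_nonneg_right (h.norm_coe_le_norm _) (norm_nonneg _)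
  · -- the integrand is continuous in `x` except where `y` is the moving endpoint
    have hne : ∀ᵐ y ∂volume.restrict (Ioc c d), y ≠ (b x₀ : ℝ) :=
      ae_restrict_of_ae (by simp [ae_iff, measure_singleton])
    filter_upwards [hne] with y hy
    have hb' : Filter.Tendsto (fun x => (b x : ℝ)) (nhds x₀) (nhds (b x₀ : ℝ)) :=
      (continuous_subtype_val.comp hb).continuousAt
    rcases lt_or_gt_of_ne hy with hlt | hgt
    · refine ((hcont y).mul (continuous_const (y := w y))).continuousAt.congr ?_
      filter_upwards [hb'.eventually (lt_mem_nhds hlt)] with x hx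
      rw [Pi.mul_apply, indicator_of_mem (show y ∈ Iic (b x : ℝ) from hx.le)]
    · refine (continuousAt_const (y := (0 : ℝ))).congr ?_
      filter_upwards [hb'.eventually (gt_mem_nhds hgt)] with x hx
      rw [indicator_of_notMem (show y ∉ Iic (b x : ℝ) from not_le.2 hx)]

variable {a b c d : ℝ}

/-- The affine Volterra operator `B ↦ -∫_c^v K(u, y) (w(y) + B(u, y)) dy` on continuous functions,
conjugated by the weight `exp (L (u + v))` that makes it a contraction for large `L`. -/
def volterraOp (hcd : c ≤ d) (L : ℝ) (K : C(Icc a b × Icc c d, ℝ)) {w : ℝ → ℝ}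
    (hw : IntervalIntegrable w volume c d) (B : C(Icc a b × Icc c d, ℝ)) :
    C(Icc a b × Icc c d, ℝ) where
  toFun z := -((∫ y in c..z.2, K (z.1, projIcc c d hcd y)
        * Real.exp (-(L * (z.1 + z.2))) * w y)
      + ∫ y in c..z.2, K (z.1, projIcc c d hcd y)
        * Real.exp (-(L * (z.2 - projIcc c d hcd y))) * B (z.1, projIcc c d hcd y) * 1)
  continuous_toFun := by
    refine Continuous.neg (Continuous.add ?_ ?_)
    · exact continuous_integral_mul hcd
        ⟨fun q : (Icc a b × Icc c d) × Icc c d => K (q.1.1, q.2)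
          * Real.exp (-(L * (q.1.1 + q.1.2))), by fun_prop⟩ hw continuous_snd
    · exact continuous_integral_mul hcd
        ⟨fun q : (Icc a b × Icc c d) × Icc c d => K (q.1.1, q.2)
          * Real.exp (-(L * (q.1.2 - q.2))) * B (q.1.1, q.2), by fun_prop⟩
        (w := fun _ => 1) intervalIntegrable_const continuous_snd

/-- With weight rate `2 C`, where `C` bounds the kernel, the operator contracts by `1 / 2`. -/
theorem dist_volterraOp_le (hcd : c ≤ d) {C : ℝ} (hC : 0 < C) (K : C(Icc a b × Icc c d, ℝ))
    (hK : ‖K‖ ≤ C) {w : ℝ → ℝ} (hw : IntervalIntegrable w volume c d)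
    (B₁ B₂ : C(Icc a b × Icc c d, ℝ)) :
    dist (volterraOp hcd (2 * C) K hw B₁) (volterraOp hcd (2 * C) K hw B₂)
      ≤ 1 / 2 * dist B₁ B₂ := by
  rw [ContinuousMap.dist_le (by positivity)]
  intro z
  have hcont : ∀ B : C(Icc a b × Icc c d, ℝ), Continuous fun y => K (z.1, projIcc c d hcd y)
      * Real.exp (-(2 * C * (z.2 - projIcc c d hcd y))) * B (z.1, projIcc c d hcd y) * 1 := by
    intro B
    have hp : Continuous (projIcc c d hcd) := continuous_projIcc
    fun_prop
  have hdiff : volterraOp hcd (2 * C) K hw B₁ z - volterraOp hcd (2 * C) K hw B₂ z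
      = -∫ y in c..z.2, K (z.1, projIcc c d hcd y)
        * Real.exp (-(2 * C * (z.2 - projIcc c d hcd y)))
        * (B₁ (z.1, projIcc c d hcd y) - B₂ (z.1, projIcc c d hcd y)) := by
    have := intervalIntegral.integral_sub ((hcont B₁).intervalIntegrable (μ := volume) c z.2)
      ((hcont B₂).intervalIntegrable c z.2)
    simp only [volterraOp, ContinuousMap.coe_mk]
    rw [neg_sub_neg, add_sub_add_left_eq_sub, ← neg_sub, ← this]
    congr 2
    funext y
    ring
  have hle : ‖∫ y in c..z.2, K (z.1, projIcc c d hcd y)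
        * Real.exp (-(2 * C * (z.2 - projIcc c d hcd y)))
        * (B₁ (z.1, projIcc c d hcd y) - B₂ (z.1, projIcc c d hcd y))‖
      ≤ ∫ y in c..z.2, C * dist B₁ B₂ * Real.exp (-(2 * C * (z.2 - y))) := by
    refine intervalIntegral.norm_integral_le_of_norm_le z.2.2.1
      (Filter.Eventually.of_forall fun y hy => ?_)
      (Continuous.intervalIntegrable (by fun_prop) _ _)
    have hyp : ((projIcc c d hcd y : Icc c d) : ℝ) = y :=
      congrArg Subtype.val (projIcc_of_mem hcd ⟨hy.1.le, hy.2.trans z.2.2.2⟩)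
    rw [norm_mul, norm_mul, hyp, Real.norm_of_nonneg (Real.exp_pos _).le]
    calc _ ≤ C * Real.exp (-(2 * C * (z.2 - y))) * dist B₁ B₂ := by
          gcongr
          · exact (K.norm_coe_le_norm _).trans hK
          · rw [Real.norm_eq_abs, ← Real.dist_eq]
            exact ContinuousMap.dist_apply_le_dist _
      _ = _ := by ring
  have hint : ∫ y in c..z.2, C * dist B₁ B₂ * Real.exp (-(2 * C * (z.2 - y)))
      = 1 / 2 * dist B₁ B₂ - 1 / 2 * dist B₁ B₂ * Real.exp (-(2 * C * (z.2 - c))) := by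
    rw [intervalIntegral.integral_eq_sub_of_hasDerivAt
      (f := fun y => 1 / 2 * dist B₁ B₂ * Real.exp (-(2 * C * (z.2 - y))))]
    · simp
    · intro y _
      have h1 : HasDerivAt (fun y : ℝ => -(2 * C * (z.2 - y))) (2 * C) y := by
        exact (((hasDerivAt_id y).const_sub (z.2 : ℝ)).const_mul (2 * C)).neg.congr_deriv (by ring)
      exact (h1.exp.const_mul (1 / 2 * dist B₁ B₂)).congr_deriv (by ring)
    · exact Continuous.intervalIntegrable (by fun_prop) _ _
  rw [Real.dist_eq, hdiff, abs_neg]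
  refine hle.trans (hint.le.trans ?_)
  have : 0 ≤ 1 / 2 * dist B₁ B₂ * Real.exp (-(2 * C * (z.2 - c))) := by positivity
  linarith

/-- Undoing the exponential weight in `volterraOp`. -/
theorem volterraOp_apply (hcd : c ≤ d) (L : ℝ) (K : C(Icc a b × Icc c d, ℝ)) {w : ℝ → ℝ}
    (hw : IntervalIntegrable w volume c d) (B : C(Icc a b × Icc c d, ℝ))
    (u : Icc a b) (v : Icc c d) :
    Real.exp (L * (u + v)) * volterraOp hcd L K hw B (u, v)
      = -∫ y in c..v, K (u, projIcc c d hcd y)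
          * (w y + Real.exp (L * (u + y)) * B (u, projIcc c d hcd y)) := by
  have hp : Continuous (projIcc c d hcd) := continuous_projIcc
  have hwv : IntervalIntegrable w volume c v := hw.mono_set (by
    rw [uIcc_of_le hcd, uIcc_of_le v.2.1]
    exact Icc_subset_Icc_right v.2.2)
  have h1 : IntervalIntegrable (fun y => K (u, projIcc c d hcd y)
      * Real.exp (-(L * (u + v))) * w y) volume c v :=
    hwv.continuousOn_mul (Continuous.continuousOn (by fun_prop))
  have h2 : IntervalIntegrable (fun y => K (u, projIcc c d hcd y)
      * Real.exp (-(L * (v - projIcc c d hcd y))) * B (u, projIcc c d hcd y) * 1) volume c v :=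
    Continuous.intervalIntegrable (by fun_prop) _ _
  simp only [volterraOp, ContinuousMap.coe_mk]
  rw [← intervalIntegral.integral_add h1 h2, mul_neg, ← intervalIntegral.integral_const_mul]
  congr 1
  refine intervalIntegral.integral_congr fun y hy => ?_
  rw [uIcc_of_le v.2.1] at hy
  have hyp : ((projIcc c d hcd y : Icc c d) : ℝ) = y :=
    congrArg Subtype.val (projIcc_of_mem hcd ⟨hy.1, hy.2.trans v.2.2⟩)
  have e1 : Real.exp (L * (u + v)) * Real.exp (-(L * (u + v))) = 1 := by
    rw [← Real.exp_add, add_neg_cancel, Real.exp_zero]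
  have e2 : Real.exp (L * (u + v)) * Real.exp (-(L * (v - y))) = Real.exp (L * (u + y)) := by
    rw [← Real.exp_add]
    ring_nf
  simp only [hyp]
  linear_combination (K (u, projIcc c d hcd y) * w y) * e1
    + (K (u, projIcc c d hcd y) * B (u, projIcc c d hcd y)) * e2

/-- The Goursat problem for the first order system `P_v = -K Q`, `Q_u = -K P` with merely
integrable data `P = P₀` on `v = c` and `Q = Q₀` on `u = a`. The corrections `α = P - P₀`,
`β = Q - Q₀` are continuous, and solve a Volterra system to which the contraction principle
applies. -/
theorem exists_goursat_system (hab : a ≤ b) (hcd : c ≤ d) {K : ℝ × ℝ → ℝ}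
    (hK : ContinuousOn K (charRect a c b d)) {P₀ Q₀ : ℝ → ℝ}
    (hP₀ : IntervalIntegrable P₀ volume a b) (hQ₀ : IntervalIntegrable Q₀ volume c d) :
    ∃ α β : ℝ × ℝ → ℝ, Continuous α ∧ Continuous β ∧ ∀ u ∈ Icc a b, ∀ v ∈ Icc c d,
      α (u, v) = -∫ y in c..v, K (u, y) * (Q₀ y + β (u, y)) ∧
      β (u, v) = -∫ x in a..u, K (x, v) * (P₀ x + α (x, v)) := by
  let K₁ : C(Icc a b × Icc c d, ℝ) := ⟨fun z => K (z.1, z.2),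
    hK.comp_continuous (by fun_prop) fun z => ⟨z.1.2, z.2.2⟩⟩
  let σ : C(Icc c d × Icc a b, Icc a b × Icc c d) := ⟨Prod.swap, continuous_swap⟩
  let τ : C(Icc a b × Icc c d, Icc c d × Icc a b) := ⟨Prod.swap, continuous_swap⟩
  let K₂ : C(Icc c d × Icc a b, ℝ) := K₁.comp σ
  set C := ‖K₁‖ + ‖K₂‖ + 1 with hC
  have hC0 : 0 < C := by positivity
  have hC1 : ‖K₁‖ ≤ C := by linarith [norm_nonneg K₂]
  have hC2 : ‖K₂‖ ≤ C := by linarith [norm_nonneg K₁]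
  let T : C(Icc a b × Icc c d, ℝ) × C(Icc a b × Icc c d, ℝ) →
      C(Icc a b × Icc c d, ℝ) × C(Icc a b × Icc c d, ℝ) := fun z =>
    (volterraOp hcd (2 * C) K₁ hQ₀ z.2,
      (volterraOp hab (2 * C) K₂ hP₀ (z.1.comp σ)).comp τ)
  have hcomp : ∀ {X Y : Type} [TopologicalSpace X] [CompactSpace X] [TopologicalSpace Y]
      [CompactSpace Y] (f g : C(X, ℝ)) (h : C(Y, X)), dist (f.comp h) (g.comp h) ≤ dist f g := by
    intro X Y _ _ _ _ f g h
    rw [ContinuousMap.dist_le dist_nonneg]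
    exact fun y => ContinuousMap.dist_apply_le_dist (h y)
  have hT : ContractingWith (1 / 2) T := by
    refine ⟨by rw [← NNReal.coe_lt_coe]; norm_num, LipschitzWith.of_dist_le_mul fun x y => ?_⟩
    rw [Prod.dist_eq (x := T x)]
    push_cast
    refine max_le ?_ ?_
    · refine (dist_volterraOp_le hcd hC0 K₁ hC1 hQ₀ x.2 y.2).trans ?_
      gcongr
      exact le_max_right _ _
    · refine (hcomp _ _ τ).trans ((dist_volterraOp_le hab hC0 K₂ hC2 hP₀ _ _).trans ?_)
      gcongr
      exact (hcomp _ _ σ).trans (le_max_left _ _)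
  obtain ⟨⟨A, B⟩, hfix⟩ : ∃ z, T z = z := ⟨_, hT.fixedPoint_isFixedPt⟩
  have hA : volterraOp hcd (2 * C) K₁ hQ₀ B = A := congrArg Prod.fst hfix
  have hB : (volterraOp hab (2 * C) K₂ hP₀ (A.comp σ)).comp τ = B := congrArg Prod.snd hfix
  have hpab : Continuous (projIcc a b hab) := continuous_projIcc
  have hpcd : Continuous (projIcc c d hcd) := continuous_projIcc
  refine ⟨fun z => Real.exp (2 * C * (z.1 + z.2)) * A (projIcc a b hab z.1, projIcc c d hcd z.2),
    fun z => Real.exp (2 * C * (z.1 + z.2)) * B (projIcc a b hab z.1, projIcc c d hcd z.2),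
    by fun_prop, by fun_prop, fun u hu v hv => ⟨?_, ?_⟩⟩
  · have h := volterraOp_apply hcd (2 * C) K₁ hQ₀ B ⟨u, hu⟩ ⟨v, hv⟩
    simp only [projIcc_of_mem hab hu, projIcc_of_mem hcd hv]
    rw [hA] at h
    refine h.trans (congrArg Neg.neg (intervalIntegral.integral_congr fun y hy => ?_))
    rw [uIcc_of_le hv.1] at hy
    simp [K₁, projIcc_of_mem hcd (show y ∈ Icc c d from ⟨hy.1, hy.2.trans hv.2⟩)]
  · have h := volterraOp_apply hab (2 * C) K₂ hP₀ (A.comp σ) ⟨v, hv⟩ ⟨u, hu⟩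
    simp only [projIcc_of_mem hab hu, projIcc_of_mem hcd hv]
    have hB' : volterraOp hab (2 * C) K₂ hP₀ (A.comp σ) (⟨v, hv⟩, ⟨u, hu⟩) = B (⟨u, hu⟩, ⟨v, hv⟩) :=
      DFunLike.congr_fun hB ((⟨u, hu⟩, ⟨v, hv⟩) : Icc a b × Icc c d)
    rw [hB'] at h
    rw [add_comm u v]
    refine h.trans (congrArg Neg.neg (intervalIntegral.integral_congr fun x hx => ?_))
    rw [uIcc_of_le hu.1] at hx
    simp [K₂, K₁, σ, projIcc_of_mem hab (show x ∈ Icc a b from ⟨hx.1, hx.2.trans hu.2⟩),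
      add_comm]

end Volterra

/-! ### The transport equations -/

section Existence

variable {u₀ v₀ u₁ v₁ : ℝ}

theorem hasDerivAt_inv_sqrt_abs {x : ℝ} (hx : x ≠ 0) :
    HasDerivAt (fun x => (√|x|)⁻¹) (-(√|x|)⁻¹ / (2 * x)) x := by
  have hpos : 0 < √|x| := Real.sqrt_pos.2 (abs_pos.2 hx)
  have h := ((hasDerivAt_abs hx).sqrt (abs_ne_zero.2 hx)).inv hpos.ne'
  refine h.congr_deriv ?_
  rw [Real.sq_sqrt (abs_nonneg x)]
  rcases lt_or_gt_of_ne hx with h0 | h0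
  · rw [sign_neg h0, abs_of_neg h0]
    have : √(-x) ≠ 0 := by rw [abs_of_neg h0] at hpos; exact hpos.ne'
    field_simp
    simp
  · rw [sign_pos h0, abs_of_pos h0]
    have : √x ≠ 0 := by rw [abs_of_pos h0] at hpos; exact hpos.ne'
    field_simp
    simp

/-- On a characteristic rectangle off the singular line, `|u + v|` is bounded below and above. -/
theorem exists_abs_add_bounds (hsing : ∀ p ∈ charRect u₀ v₀ u₁ v₁, p.1 + p.2 ≠ 0) :
    ∃ δ R : ℝ, 0 < δ ∧ 0 < R ∧ ∀ p ∈ charRect u₀ v₀ u₁ v₁, δ ≤ |p.1 + p.2| ∧ |p.1 + p.2| ≤ R := by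
  have hc : ContinuousOn (fun p : ℝ × ℝ => |p.1 + p.2|) (charRect u₀ v₀ u₁ v₁) := by fun_prop
  obtain ⟨R, hR⟩ := isCompact_charRect.bddAbove_image hc
  rcases (charRect u₀ v₀ u₁ v₁).eq_empty_or_nonempty with he | hne
  · exact ⟨1, 1, one_pos, one_pos, by simp [he]⟩
  obtain ⟨z, hz, hmin⟩ := isCompact_charRect.exists_isMinOn hne hc
  exact ⟨|z.1 + z.2|, max R 1, abs_pos.2 (hsing z hz), by positivity,
    fun p hp => ⟨hmin hp, (hR ⟨p, hp, rfl⟩).trans (le_max_left _ _)⟩⟩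

/-- The common value `f_uv = -(f_u + f_v) / (2 (u + v))` prescribed by the essential field equation
to the mixed derivative of a field with `f_u = p` and `f_v = q`. -/
def mixedDeriv (p q : ℝ × ℝ → ℝ) (z : ℝ × ℝ) : ℝ := -(p z + q z) / (2 * (z.1 + z.2))

/-- `p` and `q` are representatives of the derivatives `f_u`, `f_v` of a solution of the essential
field equation in integrated form: the transport equations `p_v = q_u = -(p + q) / (2 (u + v))` hold
along every characteristic segment, and `p`, `q` are dominated by square-integrable functions of
`u`, respectively `v`, alone. -/
structure IsEssentialPair (u₀ v₀ u₁ v₁ : ℝ) (p q : ℝ × ℝ → ℝ) : Prop where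
  measurable_left : Measurable p
  measurable_right : Measurable q
  transport_left : ∀ u ∈ Icc u₀ u₁,
    IsPrimitiveOn v₀ v₁ (fun v => p (u, v)) (fun v => mixedDeriv p q (u, v))
  transport_right : ∀ v ∈ Icc v₀ v₁,
    IsPrimitiveOn u₀ u₁ (fun u => q (u, v)) (fun u => mixedDeriv p q (u, v))
  dominated_left : ∃ m : ℝ → ℝ, MemLp m 2 (volume.restrict (Icc u₀ u₁)) ∧
    ∀ z ∈ charRect u₀ v₀ u₁ v₁, |p z| ≤ m z.1
  dominated_right : ∃ n : ℝ → ℝ, MemLp n 2 (volume.restrict (Icc v₀ v₁)) ∧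
    ∀ z ∈ charRect u₀ v₀ u₁ v₁, |q z| ≤ n z.2

theorem MeasureTheory.MemLp.integrableOn_Icc {a b : ℝ} {f : ℝ → ℝ}
    (hf : MemLp f 2 (volume.restrict (Icc a b))) : IntegrableOn f (Icc a b) :=
  hf.integrable (by norm_num)

/-- Solvability of the characteristic initial value problem for the transport equations. In terms of
`P = |u + v|^{1/2} p` and `Q = |u + v|^{1/2} q` they become `P_v = -Q / (2 (u + v))` and
`Q_u = -P / (2 (u + v))`, in which the unknowns are decoupled from their own derivatives. -/
theorem exists_isEssentialPair (hu : u₀ ≤ u₁) (hv : v₀ ≤ v₁)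
    (hsing : ∀ p ∈ charRect u₀ v₀ u₁ v₁, p.1 + p.2 ≠ 0) {p₀ q₀ : ℝ → ℝ}
    (hp₀ : Measurable p₀) (hq₀ : Measurable q₀)
    (hp₀' : MemLp p₀ 2 (volume.restrict (Icc u₀ u₁)))
    (hq₀' : MemLp q₀ 2 (volume.restrict (Icc v₀ v₁))) :
    ∃ p q, IsEssentialPair u₀ v₀ u₁ v₁ p q ∧ (∀ u ∈ Icc u₀ u₁, p (u, v₀) = p₀ u) ∧
      ∀ v ∈ Icc v₀ v₁, q (u₀, v) = q₀ v := by
  have hu0 : u₀ ∈ Icc u₀ u₁ := ⟨le_rfl, hu⟩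
  have hv0 : v₀ ∈ Icc v₀ v₁ := ⟨le_rfl, hv⟩
  obtain ⟨δ, R, hδ, hR, hb⟩ := exists_abs_add_bounds hsing
  let r : ℝ × ℝ → ℝ := fun z => √|z.1 + z.2|
  have hr : ∀ z ∈ charRect u₀ v₀ u₁ v₁, 0 < r z := fun z hz =>
    Real.sqrt_pos.2 (abs_pos.2 (hsing z hz))
  have hrinv : ∀ z ∈ charRect u₀ v₀ u₁ v₁, (r z)⁻¹ ≤ (√δ)⁻¹ := fun z hz =>
    inv_anti₀ (Real.sqrt_pos.2 hδ) (Real.sqrt_le_sqrt (hb z hz).1)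
  have hrR : ∀ z ∈ charRect u₀ v₀ u₁ v₁, r z ≤ √R := fun z hz => Real.sqrt_le_sqrt (hb z hz).2
  let K : ℝ × ℝ → ℝ := fun z => (2 * (z.1 + z.2))⁻¹
  have hK : ContinuousOn K (charRect u₀ v₀ u₁ v₁) :=
    ContinuousOn.inv₀ (by fun_prop) fun z hz => mul_ne_zero two_ne_zero (hsing z hz)
  let P₀ : ℝ → ℝ := fun u => r (u, v₀) * p₀ u
  let Q₀ : ℝ → ℝ := fun v => r (u₀, v) * q₀ v
  have hP₀ : IntervalIntegrable P₀ volume u₀ u₁ :=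
    (intervalIntegrable_of_integrableOn_Icc hu hp₀'.integrableOn_Icc).continuousOn_mul
      (Continuous.continuousOn (by fun_prop))
  have hQ₀ : IntervalIntegrable Q₀ volume v₀ v₁ :=
    (intervalIntegrable_of_integrableOn_Icc hv hq₀'.integrableOn_Icc).continuousOn_mul
      (Continuous.continuousOn (by fun_prop))
  obtain ⟨α, β, hα, hβ, hαβ⟩ := exists_goursat_system hu hv hK hP₀ hQ₀
  obtain ⟨A, hA⟩ := isCompact_charRect.exists_bound_of_continuousOn
    (s := charRect u₀ v₀ u₁ v₁) hα.continuousOn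
  obtain ⟨B, hB⟩ := isCompact_charRect.exists_bound_of_continuousOn
    (s := charRect u₀ v₀ u₁ v₁) hβ.continuousOn
  have hα0 : ∀ u ∈ Icc u₀ u₁, α (u, v₀) = 0 := fun u hu' => by
    rw [(hαβ u hu' v₀ hv0).1]; simp
  have hβ0 : ∀ v ∈ Icc v₀ v₁, β (u₀, v) = 0 := fun v hv' => by
    rw [(hαβ u₀ hu0 v hv').2]; simp
  have hrm : Measurable r := by fun_prop
  let p : ℝ × ℝ → ℝ := fun z => (P₀ z.1 + α z) * (r z)⁻¹
  let q : ℝ × ℝ → ℝ := fun z => (Q₀ z.2 + β z) * (r z)⁻¹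
  refine ⟨p, q, ⟨by fun_prop, by fun_prop, fun u hu' => ?_, fun v hv' => ?_, ?_, ?_⟩,
    fun u hu' => ?_, fun v hv' => ?_⟩
  · have hKu : ContinuousOn (fun v => K (u, v)) (Icc v₀ v₁) :=
      hK.comp (by fun_prop) fun v hv' => ⟨hu', hv'⟩
    have hi : IntervalIntegrable (fun y => -(K (u, y) * (Q₀ y + β (u, y)))) volume v₀ v₁ :=
      ((hQ₀.add (Continuous.intervalIntegrable (by fun_prop) _ _)).continuousOn_mul
        (by rwa [uIcc_of_le hv])).neg
    have hP : IsPrimitiveOn v₀ v₁ (fun v => P₀ u + α (u, v))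
        (fun y => -(K (u, y) * (Q₀ y + β (u, y)))) := by
      refine ⟨hi, fun v hv' => ?_⟩
      rw [hα0 u hu', (hαβ u hu' v hv').1, intervalIntegral.integral_neg]
      ring
    have hr' : IsPrimitiveOn v₀ v₁ (fun v => (r (u, v))⁻¹)
        (fun v => -(r (u, v))⁻¹ / (2 * (u + v))) := by
      refine .of_hasDerivAt (fun v hv' => ?_) ?_ hv
      · exact (hasDerivAt_inv_sqrt_abs (hsing (u, v) ⟨hu', hv'⟩)).comp_const_add u v
      · refine ContinuousOn.div (ContinuousOn.neg (ContinuousOn.inv₀ ?_ ?_)) ?_ ?_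
        · exact Continuous.continuousOn (by fun_prop)
        · exact fun v hv' => (hr (u, v) ⟨hu', hv'⟩).ne'
        · fun_prop
        · exact fun v hv' => mul_ne_zero two_ne_zero (hsing (u, v) ⟨hu', hv'⟩)
    refine (hP.mul hr' hv).congr hv (fun v _ => rfl) fun v _ => ?_
    simp only [mixedDeriv, p, q, K]
    ring
  · have hKv : ContinuousOn (fun u => K (u, v)) (Icc u₀ u₁) :=
      hK.comp (by fun_prop) fun u hu' => ⟨hu', hv'⟩
    have hi : IntervalIntegrable (fun x => -(K (x, v) * (P₀ x + α (x, v)))) volume u₀ u₁ :=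
      ((hP₀.add (Continuous.intervalIntegrable (by fun_prop) _ _)).continuousOn_mul
        (by rwa [uIcc_of_le hu])).neg
    have hQ : IsPrimitiveOn u₀ u₁ (fun u => Q₀ v + β (u, v))
        (fun x => -(K (x, v) * (P₀ x + α (x, v)))) := by
      refine ⟨hi, fun u hu' => ?_⟩
      rw [hβ0 v hv', (hαβ u hu' v hv').2, intervalIntegral.integral_neg]
      ring
    have hr' : IsPrimitiveOn u₀ u₁ (fun u => (r (u, v))⁻¹)
        (fun u => -(r (u, v))⁻¹ / (2 * (u + v))) := by
      refine .of_hasDerivAt (fun u hu' => ?_) ?_ hu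
      · exact (hasDerivAt_inv_sqrt_abs (hsing (u, v) ⟨hu', hv'⟩)).comp_add_const u v
      · refine ContinuousOn.div (ContinuousOn.neg (ContinuousOn.inv₀ ?_ ?_)) ?_ ?_
        · exact Continuous.continuousOn (by fun_prop)
        · exact fun u hu' => (hr (u, v) ⟨hu', hv'⟩).ne'
        · fun_prop
        · exact fun u hu' => mul_ne_zero two_ne_zero (hsing (u, v) ⟨hu', hv'⟩)
    refine (hQ.mul hr' hu).congr hu (fun u _ => rfl) fun u _ => ?_
    simp only [mixedDeriv, p, q, K]
    ring
  · refine ⟨fun u => √R * (√δ)⁻¹ * |p₀ u| + A * (√δ)⁻¹,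
      (hp₀'.abs.const_mul _).add (memLp_const _), fun z hz => ?_⟩
    have h1 : |P₀ z.1 + α z| ≤ √R * |p₀ z.1| + A := by
      refine (abs_add_le _ _).trans (add_le_add ?_ (hA z hz))
      rw [abs_mul, abs_of_nonneg (Real.sqrt_nonneg _)]
      exact mul_le_mul_of_nonneg_right (hrR (z.1, v₀) ⟨hz.1, hv0⟩) (abs_nonneg _)
    calc |p z| = |P₀ z.1 + α z| * (r z)⁻¹ := by
          rw [abs_mul, abs_of_pos (inv_pos.2 (hr z hz))]
      _ ≤ (√R * |p₀ z.1| + A) * (√δ)⁻¹ :=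
          mul_le_mul h1 (hrinv z hz) (inv_nonneg.2 (hr z hz).le) ((abs_nonneg _).trans h1)
      _ = _ := by ring
  · refine ⟨fun v => √R * (√δ)⁻¹ * |q₀ v| + B * (√δ)⁻¹,
      (hq₀'.abs.const_mul _).add (memLp_const _), fun z hz => ?_⟩
    have h1 : |Q₀ z.2 + β z| ≤ √R * |q₀ z.2| + B := by
      refine (abs_add_le _ _).trans (add_le_add ?_ (hB z hz))
      rw [abs_mul, abs_of_nonneg (Real.sqrt_nonneg _)]
      exact mul_le_mul_of_nonneg_right (hrR (u₀, z.2) ⟨hu0, hz.2⟩) (abs_nonneg _)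
    calc |q z| = |Q₀ z.2 + β z| * (r z)⁻¹ := by
          rw [abs_mul, abs_of_pos (inv_pos.2 (hr z hz))]
      _ ≤ (√R * |q₀ z.2| + B) * (√δ)⁻¹ :=
          mul_le_mul h1 (hrinv z hz) (inv_nonneg.2 (hr z hz).le) ((abs_nonneg _).trans h1)
      _ = _ := by ring
  · have := (hr (u, v₀) ⟨hu', hv0⟩).ne'
    simp only [p, P₀, hα0 u hu']
    field_simp
    ring
  · have := (hr (u₀, v) ⟨hu0, hv'⟩).ne'
    simp only [q, Q₀, hβ0 v hv']
    field_simp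
    ring

end Existence

/-! ### Existence -/

section Existence

variable {u₀ v₀ u₁ v₁ : ℝ}

theorem normL2_lt_top_iff_memLp {a b : ℝ} {g : ℝ → ℝ} (hg : Measurable g) :
    normL2 a b g < ⊤ ↔ MemLp g 2 (volume.restrict (Icc a b)) := by
  rw [MemLp, and_iff_right hg.aestronglyMeasurable,
    eLpNorm_lt_top_iff_lintegral_rpow_enorm_lt_top two_ne_zero ENNReal.ofNat_ne_top, normL2,
    ENNReal.rpow_lt_top_iff_of_pos (by norm_num)]
  simp

/-- Admissible characteristic data are the primitives of Borel functions in `L²`. -/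
theorem IsCharData.exists_isPrimitiveOn {a b : ℝ} (hab : a < b) {f : ℝ → ℝ}
    (hf : IsCharData a b f) :
    ∃ g, Measurable g ∧ MemLp g 2 (volume.restrict (Icc a b)) ∧ IsPrimitiveOn a b f g := by
  obtain ⟨hc, g, hg, hg2⟩ := hf
  have hg2' := (normL2_lt_top_iff_memLp hg.measurable).1 hg2
  exact ⟨g, hg.measurable, hg2', isPrimitiveOn_of_integral_mul_deriv hab hc
    (intervalIntegrable_of_integrableOn_Icc hab.le hg2'.integrableOn_Icc) hg.integral_eq⟩

/-- `F` is a potential of `p du + q dv` on the rectangle: all its characteristic slices are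
primitives of the slices of `p` and `q`. -/
structure IsPotential (u₀ v₀ u₁ v₁ : ℝ) (F p q : ℝ × ℝ → ℝ) : Prop where
  left : ∀ v ∈ Icc v₀ v₁, IsPrimitiveOn u₀ u₁ (fun u => F (u, v)) (fun u => p (u, v))
  right : ∀ u ∈ Icc u₀ u₁, IsPrimitiveOn v₀ v₁ (fun v => F (u, v)) (fun v => q (u, v))

theorem IsPotential.isWeakPartialU {F p q : ℝ × ℝ → ℝ} (h : IsPotential u₀ v₀ u₁ v₁ F p q)
    (hu : u₀ ≤ u₁) (hF : ContinuousOn F (charRect u₀ v₀ u₁ v₁)) (hp : Measurable p)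
    (hp' : IntegrableOn p (charRect u₀ v₀ u₁ v₁)) :
    IsWeakPartialU (charRectInt u₀ v₀ u₁ v₁) F p where
  measurable := hp
  locallyIntegrable := (hp'.mono_set charRectInt_subset).locallyIntegrableOn
  integral_eq _ hφ := setIntegral_mul_partialU hu
    ((hF.integrableOn_compact isCompact_charRect).mono_set charRectInt_subset)
    (hp'.mono_set charRectInt_subset) h.left hφ

theorem IsPotential.isWeakPartialV {F p q : ℝ × ℝ → ℝ} (h : IsPotential u₀ v₀ u₁ v₁ F p q)
    (hv : v₀ ≤ v₁) (hF : ContinuousOn F (charRect u₀ v₀ u₁ v₁)) (hq : Measurable q)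
    (hq' : IntegrableOn q (charRect u₀ v₀ u₁ v₁)) :
    IsWeakPartialV (charRectInt u₀ v₀ u₁ v₁) F q where
  measurable := hq
  locallyIntegrable := (hq'.mono_set charRectInt_subset).locallyIntegrableOn
  integral_eq _ hφ := setIntegral_mul_partialV hv
    ((hF.integrableOn_compact isCompact_charRect).mono_set charRectInt_subset)
    (hq'.mono_set charRectInt_subset) h.right hφ

theorem intervalIntegrable_slice_left {p : ℝ × ℝ → ℝ} {m : ℝ → ℝ} (hu : u₀ ≤ u₁)
    (hp : Measurable p) (hm : IntegrableOn m (Icc u₀ u₁))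
    (hpm : ∀ z ∈ charRect u₀ v₀ u₁ v₁, |p z| ≤ m z.1) {v : ℝ} (hv : v ∈ Icc v₀ v₁) :
    IntervalIntegrable (fun u => p (u, v)) volume u₀ u₁ := by
  refine intervalIntegrable_of_integrableOn_Icc hu (Integrable.mono' hm
    (Measurable.aestronglyMeasurable (by fun_prop)) ?_)
  exact (ae_restrict_iff' measurableSet_Icc).2
    (Filter.Eventually.of_forall fun u hu' => hpm (u, v) ⟨hu', hv⟩)

theorem intervalIntegrable_slice_right {q : ℝ × ℝ → ℝ} {n : ℝ → ℝ} (hv : v₀ ≤ v₁)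
    (hq : Measurable q) (hn : IntegrableOn n (Icc v₀ v₁))
    (hqn : ∀ z ∈ charRect u₀ v₀ u₁ v₁, |q z| ≤ n z.2) {u : ℝ} (hu : u ∈ Icc u₀ u₁) :
    IntervalIntegrable (fun v => q (u, v)) volume v₀ v₁ := by
  refine intervalIntegrable_of_integrableOn_Icc hv (Integrable.mono' hn
    (Measurable.aestronglyMeasurable (by fun_prop)) ?_)
  exact (ae_restrict_iff' measurableSet_Icc).2
    (Filter.Eventually.of_forall fun v hv' => hqn (u, v) ⟨hu, hv'⟩)

namespace IsEssentialPair

variable {p q : ℝ × ℝ → ℝ}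

theorem integrableOn_left (h : IsEssentialPair u₀ v₀ u₁ v₁ p q) :
    IntegrableOn p (charRect u₀ v₀ u₁ v₁) := by
  obtain ⟨m, hm, hpm⟩ := h.dominated_left
  exact integrableOn_charRect_of_abs_le_left h.measurable_left hm.integrableOn_Icc hpm

theorem integrableOn_right (h : IsEssentialPair u₀ v₀ u₁ v₁ p q) :
    IntegrableOn q (charRect u₀ v₀ u₁ v₁) := by
  obtain ⟨n, hn, hqn⟩ := h.dominated_right
  exact integrableOn_charRect_of_abs_le_right h.measurable_right hn.integrableOn_Icc hqn

theorem integrableOn_mul (h : IsEssentialPair u₀ v₀ u₁ v₁ p q) :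
    IntegrableOn (fun z => p z * q z) (charRect u₀ v₀ u₁ v₁) := by
  obtain ⟨m, hm, hpm⟩ := h.dominated_left
  obtain ⟨n, hn, hqn⟩ := h.dominated_right
  have h1 := Integrable.mul_prod hm.integrableOn_Icc hn.integrableOn_Icc
  rw [Measure.prod_restrict, ← Measure.volume_eq_prod] at h1
  refine Integrable.mono' h1 (h.measurable_left.mul h.measurable_right).aestronglyMeasurable ?_
  refine (ae_restrict_iff' measurableSet_charRect).2 (Filter.Eventually.of_forall fun z hz => ?_)
  rw [norm_mul]
  exact mul_le_mul (hpm z hz) (hqn z hz) (abs_nonneg _) ((abs_nonneg _).trans (hpm z hz))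

theorem integrableOn_mixedDeriv (h : IsEssentialPair u₀ v₀ u₁ v₁ p q)
    (hsing : ∀ p ∈ charRect u₀ v₀ u₁ v₁, p.1 + p.2 ≠ 0) :
    IntegrableOn (mixedDeriv p q) (charRect u₀ v₀ u₁ v₁) := by
  have hc : ContinuousOn (fun z : ℝ × ℝ => (2 * (z.1 + z.2))⁻¹) (charRect u₀ v₀ u₁ v₁) :=
    ContinuousOn.inv₀ (by fun_prop) fun z hz => mul_ne_zero two_ne_zero (hsing z hz)
  exact (h.integrableOn_left.add h.integrableOn_right).neg.mul_continuousOn hc isCompact_charRect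

theorem exists_isPotential (h : IsEssentialPair u₀ v₀ u₁ v₁ p q) (hu : u₀ ≤ u₁) (hv : v₀ ≤ v₁)
    (hsing : ∀ p ∈ charRect u₀ v₀ u₁ v₁, p.1 + p.2 ≠ 0) (c : ℝ) :
    ∃ f, f (u₀, v₀) = c ∧ IsPotential u₀ v₀ u₁ v₁ f p q := by
  obtain ⟨m, hm, hpm⟩ := h.dominated_left
  obtain ⟨n, hn, hqn⟩ := h.dominated_right
  obtain ⟨f, hf, hl, hr⟩ := exists_potential hu hv
    (fun v => intervalIntegrable_slice_left hu h.measurable_left hm.integrableOn_Icc hpm)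
    (fun u => intervalIntegrable_slice_right hv h.measurable_right hn.integrableOn_Icc hqn)
    (h.integrableOn_mixedDeriv hsing) h.transport_left h.transport_right c
  exact ⟨f, hf, hl, hr⟩

theorem continuousOn (h : IsEssentialPair u₀ v₀ u₁ v₁ p q) (hu : u₀ ≤ u₁) (hv : v₀ ≤ v₁)
    {f : ℝ × ℝ → ℝ} (hf : IsPotential u₀ v₀ u₁ v₁ f p q) :
    ContinuousOn f (charRect u₀ v₀ u₁ v₁) := by
  obtain ⟨m, hm, hpm⟩ := h.dominated_left
  obtain ⟨n, hn, hqn⟩ := h.dominated_right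
  exact continuousOn_charRect hu hv hf.left hf.right hm.integrableOn_Icc hn.integrableOn_Icc hpm hqn

theorem seminormU_lt_top (h : IsEssentialPair u₀ v₀ u₁ v₁ p q) : seminormU u₀ v₀ u₁ v₁ p < ⊤ := by
  obtain ⟨m, hm, hpm⟩ := h.dominated_left
  exact _root_.seminormU_lt_top hm.integrable_sq fun z hz => sq_le_sq.2
    ((hpm z hz).trans (le_abs_self _))

theorem seminormV_lt_top (h : IsEssentialPair u₀ v₀ u₁ v₁ p q) : seminormV u₀ v₀ u₁ v₁ q < ⊤ := by
  obtain ⟨n, hn, hqn⟩ := h.dominated_right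
  exact _root_.seminormV_lt_top hn.integrable_sq fun z hz => sq_le_sq.2
    ((hqn z hz).trans (le_abs_self _))

/-- Two integrations by parts, first in `u` and then in `v`, reduce the distributional equation to
the transport equation for `f_u`. -/
theorem essentialEqDistr (h : IsEssentialPair u₀ v₀ u₁ v₁ p q) (hu : u₀ ≤ u₁) (hv : v₀ ≤ v₁)
    (hsing : ∀ p ∈ charRect u₀ v₀ u₁ v₁, p.1 + p.2 ≠ 0)
    {f : ℝ × ℝ → ℝ} (hf : IsPotential u₀ v₀ u₁ v₁ f p q) :
    EssentialEqDistr (charRectInt u₀ v₀ u₁ v₁) f p q := by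
  intro φ hφ
  have hΦ : IsTestFunction (charRectInt u₀ v₀ u₁ v₁) (fun z => 2 * (z.1 + z.2) * φ z) :=
    ⟨ContDiff.mul (by fun_prop) hφ.smooth, hφ.compact.mul_left,
      tsupport_mul_subset_right.trans hφ.support_subset⟩
  have hfi := ((h.continuousOn hu hv hf).integrableOn_compact (μ := volume)
    isCompact_charRect).mono_set charRectInt_subset
  have hpi := h.integrableOn_left.mono_set charRectInt_subset
  have hgi := (h.integrableOn_mixedDeriv hsing).mono_set charRectInt_subset
  rw [setIntegral_mul_partialU hu hfi hpi hf.left hΦ.partialV,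
    setIntegral_mul_partialV hv hpi hgi h.transport_left hΦ, neg_neg, add_comm,
    ← eq_neg_iff_add_eq_zero, ← integral_neg]
  refine setIntegral_congr_fun (isOpen_charRectInt.measurableSet) fun z hz => ?_
  have := hsing z (charRectInt_subset hz)
  simp only [mixedDeriv]
  field_simp

end IsEssentialPair

/-- Existence and regularity for the characteristic initial value problem of the essential field
equation. -/
theorem exists_essential_field (hu : u₀ < u₁) (hv : v₀ < v₁)
    (hsing : ∀ p ∈ charRect u₀ v₀ u₁ v₁, p.1 + p.2 ≠ 0) {fN fM : ℝ → ℝ}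
    (hN : IsCharData u₀ u₁ fN) (hM : IsCharData v₀ v₁ fM) (hNM : fN u₀ = fM v₀) :
    ∃ f p q : ℝ × ℝ → ℝ, IsEssentialPair u₀ v₀ u₁ v₁ p q ∧ IsPotential u₀ v₀ u₁ v₁ f p q ∧
      (∀ u ∈ Icc u₀ u₁, f (u, v₀) = fN u) ∧ ∀ v ∈ Icc v₀ v₁, f (u₀, v) = fM v := by
  obtain ⟨p₀, hp₀, hp₀', hNp⟩ := hN.exists_isPrimitiveOn hu
  obtain ⟨q₀, hq₀, hq₀', hMq⟩ := hM.exists_isPrimitiveOn hv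
  obtain ⟨p, q, hpq, hp, hq⟩ := exists_isEssentialPair hu.le hv.le hsing hp₀ hq₀ hp₀' hq₀'
  obtain ⟨f, hf0, hf⟩ := hpq.exists_isPotential hu.le hv.le hsing (fN u₀)
  refine ⟨f, p, q, hpq, hf, fun u hu' => ?_, fun v hv' => ?_⟩
  · rw [(hf.left v₀ ⟨le_rfl, hv.le⟩).eq_add u hu', hNp.eq_add u hu', hf0]
    congr 1
    refine intervalIntegral.integral_congr fun x hx => ?_
    rw [uIcc_of_le hu'.1] at hx
    exact hp x ⟨hx.1, hx.2.trans hu'.2⟩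
  · rw [(hf.right u₀ ⟨le_rfl, hu.le⟩).eq_add v hv', hMq.eq_add v hv', hf0, hNM]
    congr 1
    refine intervalIntegral.integral_congr fun y hy => ?_
    rw [uIcc_of_le hv'.1] at hy
    exact hq y ⟨hy.1, hy.2.trans hv'.2⟩

/-- The right-hand side of the constraint equations for `a_u` and `a_v`. -/
def constraintRHS (κ : ℝ) (cx ψx : ℝ × ℝ → ℝ) (z : ℝ × ℝ) : ℝ :=
  (cx z ^ 2 + κ * ψx z ^ 2) * (z.1 + z.2) - 1 / 4 * (z.1 + z.2)⁻¹

theorem measurable_constraintRHS {κ : ℝ} {cx ψx : ℝ × ℝ → ℝ} (hc : Measurable cx)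
    (hψ : Measurable ψx) : Measurable (constraintRHS κ cx ψx) := by
  unfold constraintRHS
  fun_prop

theorem abs_constraintRHS_le {κ δ R x y : ℝ} (hκ : 0 < κ) (hδ : 0 < δ) {cx ψx : ℝ × ℝ → ℝ}
    {z : ℝ × ℝ} (hz : δ ≤ |z.1 + z.2| ∧ |z.1 + z.2| ≤ R) (hc : |cx z| ≤ x) (hψ : |ψx z| ≤ y) :
    |constraintRHS κ cx ψx z| ≤ (x ^ 2 + κ * y ^ 2) * R + 1 / 4 * δ⁻¹ := by
  have hc2 : cx z ^ 2 ≤ x ^ 2 := sq_le_sq.2 (hc.trans (le_abs_self _))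
  have hψ2 : ψx z ^ 2 ≤ y ^ 2 := sq_le_sq.2 (hψ.trans (le_abs_self _))
  refine (abs_sub _ _).trans (add_le_add ?_ ?_)
  · rw [abs_mul, abs_of_nonneg (by positivity : 0 ≤ cx z ^ 2 + κ * ψx z ^ 2)]
    exact mul_le_mul (by gcongr) hz.2 (abs_nonneg _) (by positivity)
  · rw [abs_mul, abs_inv, abs_of_nonneg (by norm_num : (0 : ℝ) ≤ 1 / 4)]
    exact mul_le_mul_of_nonneg_left (inv_anti₀ hδ hz.1) (by norm_num)

theorem sq_sqrt_abs (x : ℝ) : √|x| ^ 2 = |x| := Real.sq_sqrt (abs_nonneg x)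

/-- Integrability condition for the constraints: by the transport equations,
`∂_v (c_u² (u + v)) = -c_u c_v`, an expression symmetric in `u` and `v`. -/
theorem isPrimitiveOn_sq_mul {a b s : ℝ} (hab : a ≤ b) {P g Q : ℝ → ℝ}
    (hP : IsPrimitiveOn a b P g) (hg : ∀ x ∈ Icc a b, 2 * (s + x) * g x = -(P x + Q x)) :
    IsPrimitiveOn a b (fun x => P x ^ 2 * (s + x)) (fun x => -(P x * Q x)) := by
  have hs : IsPrimitiveOn a b (fun x => s + x) (fun _ => 1) :=
    .of_hasDerivAt (fun x _ => (hasDerivAt_id x).const_add s) continuousOn_const hab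
  refine ((hP.mul hP hab).mul hs hab).congr hab (fun x _ => by ring) fun x hx => ?_
  linear_combination (-P x) * hg x hx

theorem isPrimitiveOn_inv {a b s : ℝ} (hab : a ≤ b) (hs : ∀ x ∈ Icc a b, s + x ≠ 0) :
    IsPrimitiveOn a b (fun x => -(1 / 4 * (s + x)⁻¹)) (fun x => 1 / 4 * ((s + x) ^ 2)⁻¹) := by
  refine .of_hasDerivAt (fun x hx => ?_) ?_ hab
  · have h1 : HasDerivAt (fun x => s + x) 1 x := (hasDerivAt_id x).const_add s
    refine ((h1.fun_inv (hs x hx)).const_mul (1 / 4)).fun_neg.congr_deriv ?_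
    ring
  · exact continuousOn_const.mul (ContinuousOn.inv₀ (by fun_prop) fun x hx =>
      pow_ne_zero 2 (hs x hx))

/-- The constraint equations are integrable: they have a continuous solution `a`. -/
theorem exists_constraint_potential {κ : ℝ} (hκ : 0 < κ) (hu : u₀ < u₁) (hv : v₀ < v₁)
    (hsing : ∀ p ∈ charRect u₀ v₀ u₁ v₁, p.1 + p.2 ≠ 0) {cu cv ψu ψv : ℝ × ℝ → ℝ}
    (hc : IsEssentialPair u₀ v₀ u₁ v₁ cu cv) (hψ : IsEssentialPair u₀ v₀ u₁ v₁ ψu ψv) :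
    ∃ a : ℝ × ℝ → ℝ, a (u₀, v₀) = 0 ∧ ContinuousOn a (charRect u₀ v₀ u₁ v₁) ∧
      IsWeakPartialU (charRectInt u₀ v₀ u₁ v₁) a (constraintRHS κ cu ψu) ∧
      IsWeakPartialV (charRectInt u₀ v₀ u₁ v₁) a (constraintRHS κ cv ψv) ∧
      seminormU u₀ v₀ u₁ v₁ (fun z => √|constraintRHS κ cu ψu z|) < ⊤ ∧
      seminormV u₀ v₀ u₁ v₁ (fun z => √|constraintRHS κ cv ψv z|) < ⊤ := by
  obtain ⟨δ, R, hδ, hR, hb⟩ := exists_abs_add_bounds hsing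
  obtain ⟨mc, hmc, hmc'⟩ := hc.dominated_left
  obtain ⟨nc, hnc, hnc'⟩ := hc.dominated_right
  obtain ⟨mψ, hmψ, hmψ'⟩ := hψ.dominated_left
  obtain ⟨nψ, hnψ, hnψ'⟩ := hψ.dominated_right
  set p := constraintRHS κ cu ψu
  set q := constraintRHS κ cv ψv
  have hpm : Measurable p := measurable_constraintRHS hc.measurable_left hψ.measurable_left
  have hqm : Measurable q := measurable_constraintRHS hc.measurable_right hψ.measurable_right
  let m : ℝ → ℝ := fun u => (mc u ^ 2 + κ * mψ u ^ 2) * R + 1 / 4 * δ⁻¹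
  let n : ℝ → ℝ := fun v => (nc v ^ 2 + κ * nψ v ^ 2) * R + 1 / 4 * δ⁻¹
  have hm : IntegrableOn m (Icc u₀ u₁) :=
    ((hmc.integrable_sq.add (hmψ.integrable_sq.const_mul κ)).mul_const R).add
      (integrable_const _)
  have hn : IntegrableOn n (Icc v₀ v₁) :=
    ((hnc.integrable_sq.add (hnψ.integrable_sq.const_mul κ)).mul_const R).add
      (integrable_const _)
  have hpm' : ∀ z ∈ charRect u₀ v₀ u₁ v₁, |p z| ≤ m z.1 := fun z hz =>
    abs_constraintRHS_le hκ hδ (hb z hz) (hmc' z hz) (hmψ' z hz)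
  have hqn' : ∀ z ∈ charRect u₀ v₀ u₁ v₁, |q z| ≤ n z.2 := fun z hz =>
    abs_constraintRHS_le hκ hδ (hb z hz) (hnc' z hz) (hnψ' z hz)
  -- the common value of the mixed derivatives `a_uv` and `a_vu`
  let g : ℝ × ℝ → ℝ := fun z =>
    -(cu z * cv z) + κ * -(ψu z * ψv z) + 1 / 4 * ((z.1 + z.2) ^ 2)⁻¹
  have hg : IntegrableOn g (charRect u₀ v₀ u₁ v₁) := by
    refine (hc.integrableOn_mul.neg.add (hψ.integrableOn_mul.neg.const_mul κ)).add ?_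
    refine ContinuousOn.integrableOn_compact isCompact_charRect ?_
    exact continuousOn_const.mul (ContinuousOn.inv₀ (by fun_prop) fun z hz =>
      pow_ne_zero 2 (hsing z hz))
  have hpg : ∀ u ∈ Icc u₀ u₁, IsPrimitiveOn v₀ v₁ (fun v => p (u, v)) (fun v => g (u, v)) := by
    intro u hu'
    have key : ∀ P Q : ℝ × ℝ → ℝ, ∀ v ∈ Icc v₀ v₁,
        2 * (u + v) * mixedDeriv P Q (u, v) = -(P (u, v) + Q (u, v)) := by
      intro P Q v hv'
      have : u + v ≠ 0 := hsing (u, v) ⟨hu', hv'⟩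
      simp only [mixedDeriv]
      field_simp
    have h1 := isPrimitiveOn_sq_mul (Q := fun v => cv (u, v)) hv.le
      (hc.transport_left u hu') (key cu cv)
    have h2 := isPrimitiveOn_sq_mul (Q := fun v => ψv (u, v)) hv.le
      (hψ.transport_left u hu') (key ψu ψv)
    have h3 := isPrimitiveOn_inv hv.le fun v hv' => hsing (u, v) ⟨hu', hv'⟩
    refine ((h1.add (h2.const_mul κ)).add h3).congr hv.le (fun v _ => ?_) fun v _ => rfl
    simp only [p, constraintRHS]
    ring
  have hqg : ∀ v ∈ Icc v₀ v₁, IsPrimitiveOn u₀ u₁ (fun u => q (u, v)) (fun u => g (u, v)) := by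
    intro v hv'
    have key : ∀ P Q : ℝ × ℝ → ℝ, ∀ u ∈ Icc u₀ u₁,
        2 * (v + u) * mixedDeriv P Q (u, v) = -(Q (u, v) + P (u, v)) := by
      intro P Q u hu'
      have : u + v ≠ 0 := hsing (u, v) ⟨hu', hv'⟩
      rw [add_comm v u]
      simp only [mixedDeriv]
      field_simp
      ring
    have h1 := isPrimitiveOn_sq_mul (Q := fun u => cu (u, v)) hu.le
      (hc.transport_right v hv') (key cu cv)
    have h2 := isPrimitiveOn_sq_mul (Q := fun u => ψu (u, v)) hu.le
      (hψ.transport_right v hv') (key ψu ψv)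
    have h3 := isPrimitiveOn_inv hu.le fun u hu' => by
      rw [add_comm]
      exact hsing (u, v) ⟨hu', hv'⟩
    refine ((h1.add (h2.const_mul κ)).add h3).congr hu.le (fun u _ => ?_) fun u _ => ?_
    · simp only [q, constraintRHS, add_comm v u]
      ring
    · simp only [g, add_comm v u]
      ring
  obtain ⟨a, ha0, hl, hr⟩ := exists_potential hu.le hv.le
    (fun v => intervalIntegrable_slice_left hu.le hpm hm hpm')
    (fun u => intervalIntegrable_slice_right hv.le hqm hn hqn') hg hpg hqg 0
  have ha : IsPotential u₀ v₀ u₁ v₁ a p q := ⟨hl, hr⟩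
  have hac := continuousOn_charRect hu.le hv.le hl hr hm hn hpm' hqn'
  refine ⟨a, ha0, hac, ha.isWeakPartialU hu.le hac hpm ?_, ha.isWeakPartialV hv.le hac hqm ?_,
    seminormU_lt_top hm fun z hz => ?_, seminormV_lt_top hn fun z hz => ?_⟩
  · exact integrableOn_charRect_of_abs_le_left hpm hm hpm'
  · exact integrableOn_charRect_of_abs_le_right hqm hn hqn'
  · rw [sq_sqrt_abs]
    exact hpm' z hz
  · rw [sq_sqrt_abs]
    exact hqn' z hz

/-- Existence of a regular spacetime with prescribed characteristic data. -/
theorem exists_isW12RegularSpacetime {κ : ℝ} (hκ : 0 < κ) (hu : u₀ < u₁) (hv : v₀ < v₁)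
    (hsing : ∀ p ∈ charRect u₀ v₀ u₁ v₁, p.1 + p.2 ≠ 0) {cN ψN cM ψM : ℝ → ℝ}
    (hcN : IsCharData u₀ u₁ cN) (hψN : IsCharData u₀ u₁ ψN)
    (hcM : IsCharData v₀ v₁ cM) (hψM : IsCharData v₀ v₁ ψM)
    (hc : cN u₀ = cM v₀) (hψ : ψN u₀ = ψM v₀) :
    ∃ a b c ψ : ℝ × ℝ → ℝ, IsW12RegularSpacetime κ u₀ v₀ u₁ v₁ a b c ψ ∧
      AssumesCharData u₀ v₀ u₁ v₁ cN ψN cM ψM c ψ := by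
  obtain ⟨c, cu, cv, hcp, hcf, hcN', hcM'⟩ := exists_essential_field hu hv hsing hcN hcM hc
  obtain ⟨ψ, ψu, ψv, hψp, hψf, hψN', hψM'⟩ := exists_essential_field hu hv hsing hψN hψM hψ
  obtain ⟨a, ha0, hac, hau, hav, hsu, hsv⟩ :=
    exists_constraint_potential hκ hu hv hsing hcp hψp
  have hcc := hcp.continuousOn hu.le hv.le hcf
  have hψc := hψp.continuousOn hu.le hv.le hψf
  refine ⟨a, fun p => 1 / 2 * Real.log (1 / 2 * |p.1 + p.2|), c, ψ,
    ⟨hac, ?_, hcc, hψc, fun _ _ => rfl, ⟨_, _, cu, cv, ψu, ψv, hau, hav,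
      hcf.isWeakPartialU hu.le hcc hcp.measurable_left hcp.integrableOn_left,
      hcf.isWeakPartialV hv.le hcc hcp.measurable_right hcp.integrableOn_right,
      hψf.isWeakPartialU hu.le hψc hψp.measurable_left hψp.integrableOn_left,
      hψf.isWeakPartialV hv.le hψc hψp.measurable_right hψp.integrableOn_right,
      ?_, ?_, hψp.essentialEqDistr hu.le hv.le hsing hψf,
      hcp.essentialEqDistr hu.le hv.le hsing hcf, fun _ _ => rfl, fun _ _ => rfl⟩, ha0⟩,
    ⟨hcN', hψN', hcM', hψM'⟩⟩
  · refine continuousOn_const.mul (ContinuousOn.log (by fun_prop) fun z hz => ?_)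
    exact mul_ne_zero (by norm_num) (abs_ne_zero.2 (hsing z hz))
  · exact ENNReal.add_lt_top.2 ⟨ENNReal.add_lt_top.2 ⟨hsu, hcp.seminormU_lt_top⟩,
      hψp.seminormU_lt_top⟩
  · exact ENNReal.add_lt_top.2 ⟨ENNReal.add_lt_top.2 ⟨hsv, hcp.seminormV_lt_top⟩,
      hψp.seminormV_lt_top⟩

end Existence

/-! ### Uniqueness for the essential field equation -/

section Uniqueness

variable {u₀ v₀ u₁ v₁ : ℝ}

theorem IsTestFunction.integrableOn_mul_of_locallyIntegrableOn {U : Set (ℝ × ℝ)}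
    {φ g : ℝ × ℝ → ℝ} (hφ : IsTestFunction U φ) (hg : LocallyIntegrableOn g U) :
    IntegrableOn (fun z => g z * φ z) U := by
  have h1 := hφ.integrableOn_mul
    (hg.integrableOn_compact_subset hφ.support_subset hφ.compact.isCompact)
  refine ((integrableOn_iff_integrable_of_support_subset fun z hz => ?_).1 h1).integrableOn
  exact subset_tsupport _ (right_ne_zero_of_mul hz)

/-- A locally integrable function is determined almost everywhere by its distribution. -/
theorem ae_eq_of_setIntegral_mul_eq {U : Set (ℝ × ℝ)} (hU : IsOpen U) {g h : ℝ × ℝ → ℝ}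
    (hg : LocallyIntegrableOn g U) (hh : LocallyIntegrableOn h U)
    (H : ∀ φ, IsTestFunction U φ → ∫ z in U, g z * φ z = ∫ z in U, h z * φ z) :
    ∀ᵐ z ∂volume.restrict U, g z = h z := by
  have key := hU.ae_eq_zero_of_integral_contDiff_smul_eq_zero (μ := volume) (hg.sub hh)
    (fun φ h1 h2 h3 => by
      have hφ : IsTestFunction U φ := ⟨h1, h2, h3⟩
      rw [← setIntegral_eq_integral_of_forall_compl_eq_zero (s := U)
        (fun x hx => by simp [hφ.eq_zero hx])]
      have e : ∀ z, φ z • (g - h) z = g z * φ z - h z * φ z := fun z => by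
        simp only [Pi.sub_apply, smul_eq_mul]
        ring
      simp_rw [e]
      rw [integral_sub (hφ.integrableOn_mul_of_locallyIntegrableOn hg)
        (hφ.integrableOn_mul_of_locallyIntegrableOn hh), H φ hφ, sub_self])
  rw [ae_restrict_iff' hU.measurableSet]
  filter_upwards [key] with z hz hzU
  exact sub_eq_zero.1 (hz hzU)

theorem eq_zero_of_integral_mul_eq_zero {a b : ℝ} (hab : a < b) {G : ℝ → ℝ}
    (hG : ContinuousOn G (Icc a b))
    (h : ∀ χ, IsTestFunction (Ioo a b) χ → ∫ x in Ioo a b, G x * χ x = 0) :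
    ∀ x ∈ Icc a b, G x = 0 := by
  have hae : ∀ᵐ x, x ∈ Ioo a b → G x = 0 := by
    refine isOpen_Ioo.ae_eq_zero_of_integral_contDiff_smul_eq_zero
      ((hG.mono Ioo_subset_Icc_self).locallyIntegrableOn measurableSet_Ioo) ?_
    intro φ h1 h2 h3
    have hφ : IsTestFunction (Ioo a b) φ := ⟨h1, h2, h3⟩
    rw [← setIntegral_eq_integral_of_forall_compl_eq_zero (s := Ioo a b)
      (fun x hx => by simp [hφ.eq_zero hx]), ← h φ hφ]
    simp only [smul_eq_mul, mul_comm]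
  have hEq : EqOn G (fun _ => 0) (Ioo a b) := by
    refine Measure.eqOn_open_of_ae_eq (μ := volume) ?_ isOpen_Ioo
      (hG.mono Ioo_subset_Icc_self) continuousOn_const
    rwa [Filter.EventuallyEq, ae_restrict_iff' measurableSet_Ioo]
  exact hEq.of_subset_closure hG continuousOn_const Ioo_subset_Icc_self
    (by rw [closure_Ioo hab.ne])

theorem IsTestFunction.tensor {χ θ : ℝ → ℝ} (hχ : IsTestFunction (Ioo u₀ u₁) χ)
    (hθ : IsTestFunction (Ioo v₀ v₁) θ) :
    IsTestFunction (charRectInt u₀ v₀ u₁ v₁) (fun z => χ z.1 * θ z.2) := by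
  have hs : tsupport (fun z : ℝ × ℝ => χ z.1 * θ z.2) ⊆ tsupport χ ×ˢ tsupport θ := by
    refine closure_minimal (fun z hz => ?_) ((isClosed_tsupport χ).prod (isClosed_tsupport θ))
    exact ⟨subset_tsupport _ (left_ne_zero_of_mul hz), subset_tsupport _ (right_ne_zero_of_mul hz)⟩
  refine ⟨(hχ.smooth.comp contDiff_fst).mul (hθ.smooth.comp contDiff_snd), ?_,
    hs.trans (prod_mono hχ.support_subset hθ.support_subset)⟩
  exact (hχ.compact.isCompact.prod hθ.compact.isCompact).of_isClosed_subset (isClosed_tsupport _) hs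

/-- Division by a smooth function without zeros in `U` preserves test functions on `U`. -/
theorem IsTestFunction.mul_inv {U : Set (ℝ × ℝ)} {φ s : ℝ × ℝ → ℝ} (hφ : IsTestFunction U φ)
    (hs : ContDiff ℝ ∞ s) (hsU : ∀ z ∈ U, s z ≠ 0) :
    IsTestFunction U (fun z => φ z * (s z)⁻¹) where
  smooth := by
    rw [contDiff_iff_contDiffAt]
    intro z
    by_cases hz : z ∈ tsupport φ
    · exact hφ.smooth.contDiffAt.mul (hs.contDiffAt.inv (hsU z (hφ.support_subset hz)))
    · refine (contDiffAt_const (c := (0 : ℝ))).congr_of_eventuallyEq ?_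
      filter_upwards [(isClosed_tsupport φ).isOpen_compl.mem_nhds hz] with w hw
      rw [image_eq_zero_of_notMem_tsupport hw, zero_mul]
  compact := hφ.compact.mul_right
  support_subset := tsupport_mul_subset_left.trans hφ.support_subset

theorem continuousOn_setIntegral {G : ℝ × ℝ → ℝ} (hv : v₀ ≤ v₁)
    (hG : ContinuousOn G (charRect u₀ v₀ u₁ v₁)) :
    ContinuousOn (fun u => ∫ v in Ioo v₀ v₁, G (u, v)) (Icc u₀ u₁) := by
  rw [continuousOn_iff_continuous_domRestrict]
  have h := continuous_integral_mul (X := Icc u₀ u₁) hv ⟨fun z => G (z.1, z.2),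
    hG.comp_continuous (by fun_prop) fun z => ⟨z.1.2, z.2.2⟩⟩ (w := fun _ => 1)
    intervalIntegrable_const (b := fun _ => ⟨v₁, hv, le_rfl⟩) continuous_const
  refine h.congr fun u => ?_
  rw [intervalIntegral.integral_of_le hv, integral_Ioc_eq_integral_Ioo]
  refine setIntegral_congr_fun measurableSet_Ioo fun v hv' => ?_
  simp [projIcc_of_mem hv (Ioo_subset_Icc_self hv')]

theorem continuousOn_swap {G : ℝ × ℝ → ℝ} (hG : ContinuousOn G (charRect u₀ v₀ u₁ v₁)) :
    ContinuousOn (fun z : ℝ × ℝ => G (z.2, z.1)) (charRect v₀ u₀ v₁ u₁) :=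
  hG.comp (by fun_prop) fun _ hz => ⟨hz.2, hz.1⟩

theorem continuousOn_intervalIntegral_left {G : ℝ × ℝ → ℝ}
    (hG : ContinuousOn G (charRect u₀ v₀ u₁ v₁)) {u : ℝ} (hu : u ∈ Icc u₀ u₁) :
    ContinuousOn (fun v => ∫ x in u₀..u, G (x, v)) (Icc v₀ v₁) := by
  have h := continuousOn_setIntegral (u₀ := v₀) (u₁ := v₁) hu.1 (continuousOn_swap
    (hG.mono (prod_mono (Icc_subset_Icc_right hu.2) subset_rfl)))
  refine h.congr fun v _ => ?_
  simp only [intervalIntegral.integral_of_le hu.1, integral_Ioc_eq_integral_Ioo]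

/-- If the weak derivative in the second variable of a continuous function vanishes, then the
function depends on the first variable only. -/
theorem eq_of_integral_integral_mul_deriv_eq_zero {G : ℝ × ℝ → ℝ} (hu : u₀ < u₁) (hv : v₀ < v₁)
    (hG : ContinuousOn G (charRect u₀ v₀ u₁ v₁))
    (h : ∀ χ θ, IsTestFunction (Ioo u₀ u₁) χ → IsTestFunction (Ioo v₀ v₁) θ →
      ∫ x in Ioo u₀ u₁, (∫ y in Ioo v₀ v₁, G (x, y) * deriv θ y) * χ x = 0) :
    ∀ x ∈ Icc u₀ u₁, ∀ y ∈ Icc v₀ v₁, G (x, y) = G (x, v₀) := by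
  intro x hx
  refine eq_const_of_integral_mul_deriv_eq_zero hv
    (hG.comp (by fun_prop) fun y hy => ⟨hx, hy⟩) fun θ hθ => ?_
  have hc : ContinuousOn (fun z : ℝ × ℝ => G z * deriv θ z.2) (charRect u₀ v₀ u₁ v₁) :=
    hG.mul ((hθ.smooth.continuous_deriv (by simp)).comp continuous_snd).continuousOn
  exact eq_zero_of_integral_mul_eq_zero hu (continuousOn_setIntegral hv.le hc)
    (fun χ hχ => h χ θ hχ hθ) x hx

theorem integrableOn_charRectInt_of_continuousOn {G : ℝ × ℝ → ℝ}
    (hG : ContinuousOn G (charRect u₀ v₀ u₁ v₁)) : IntegrableOn G (charRectInt u₀ v₀ u₁ v₁) :=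
  (hG.integrableOn_compact isCompact_charRect).mono_set charRectInt_subset

theorem partialU_tensor (χ θ : ℝ → ℝ) :
    partialU (fun z => χ z.1 * θ z.2) = fun z => deriv χ z.1 * θ z.2 :=
  funext fun z => by simp [partialU]

theorem partialV_tensor (χ θ : ℝ → ℝ) :
    partialV (fun z => χ z.1 * θ z.2) = fun z => χ z.1 * deriv θ z.2 :=
  funext fun z => by simp [partialV]

/-- A continuous function on the rectangle with vanishing distributional gradient is constant. -/
theorem eq_corner_of_integral_mul_partial_eq_zero {G : ℝ × ℝ → ℝ} (hu : u₀ < u₁) (hv : v₀ < v₁)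
    (hG : ContinuousOn G (charRect u₀ v₀ u₁ v₁))
    (hGu : ∀ φ, IsTestFunction (charRectInt u₀ v₀ u₁ v₁) φ →
      ∫ z in charRectInt u₀ v₀ u₁ v₁, G z * partialU φ z = 0)
    (hGv : ∀ φ, IsTestFunction (charRectInt u₀ v₀ u₁ v₁) φ →
      ∫ z in charRectInt u₀ v₀ u₁ v₁, G z * partialV φ z = 0) :
    ∀ z ∈ charRect u₀ v₀ u₁ v₁, G z = G (u₀, v₀) := by
  have hV := eq_of_integral_integral_mul_deriv_eq_zero hu hv hG (fun χ θ hχ hθ => by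
    have h := hGv _ (hχ.tensor hθ)
    rw [setIntegral_charRectInt ((hχ.tensor hθ).partialV.integrableOn_mul
      (integrableOn_charRectInt_of_continuousOn hG)), partialV_tensor] at h
    rw [← h]
    congr 1
    funext x
    rw [← integral_mul_const]
    congr 1
    funext y
    ring)
  have hU := eq_of_integral_integral_mul_deriv_eq_zero hv hu (continuousOn_swap hG)
    (fun θ χ hθ hχ => by
    have h := hGu _ (hχ.tensor hθ)
    rw [setIntegral_charRectInt_symm ((hχ.tensor hθ).partialU.integrableOn_mul
      (integrableOn_charRectInt_of_continuousOn hG)), partialU_tensor] at h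
    rw [← h]
    congr 1
    funext y
    rw [← integral_mul_const]
    congr 1
    funext x
    ring)
  intro z hz
  exact (hV z.1 hz.1 z.2 hz.2).trans (hU v₀ ⟨le_rfl, hv.le⟩ z.1 hz.1)

/-- The weak formulation of the essential field equation tested against `χ(u) θ(v) / (2 (u + v))`,
with all derivatives moved to the test function; here `k = 1 / (2 (u + v))`. -/
theorem EssentialEqDistr.integral_tensor {f p q : ℝ × ℝ → ℝ}
    (hsing : ∀ p ∈ charRect u₀ v₀ u₁ v₁, p.1 + p.2 ≠ 0)
    (hf : ContinuousOn f (charRect u₀ v₀ u₁ v₁))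
    (h : EssentialEqDistr (charRectInt u₀ v₀ u₁ v₁) f p q)
    (hp : IsWeakPartialU (charRectInt u₀ v₀ u₁ v₁) f p)
    (hq : IsWeakPartialV (charRectInt u₀ v₀ u₁ v₁) f q) {χ θ : ℝ → ℝ}
    (hχ : IsTestFunction (Ioo u₀ u₁) χ) (hθ : IsTestFunction (Ioo v₀ v₁) θ) :
    ∫ z in charRectInt u₀ v₀ u₁ v₁, f z *
      (deriv χ z.1 * (deriv θ z.2 - (2 * (z.1 + z.2))⁻¹ * θ z.2)
        - χ z.1 * ((2 * (z.1 + z.2))⁻¹ * deriv θ z.2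
          - 4 * ((2 * (z.1 + z.2))⁻¹) ^ 2 * θ z.2)) = 0 := by
  set U := charRectInt u₀ v₀ u₁ v₁
  have hs0 : ∀ z ∈ U, z.1 + z.2 ≠ 0 := fun z hz => hsing z (charRectInt_subset hz)
  have hψ : IsTestFunction U (fun z => χ z.1 * θ z.2) := hχ.tensor hθ
  have hφ := hψ.mul_inv (s := fun z => 2 * (z.1 + z.2)) (by fun_prop)
    (fun z hz => mul_ne_zero two_ne_zero (hs0 z hz))
  set φ : ℝ × ℝ → ℝ := fun z => χ z.1 * θ z.2 * (2 * (z.1 + z.2))⁻¹ with hφdef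
  have hfi : IntegrableOn f U := integrableOn_charRectInt_of_continuousOn hf
  have h0 := h φ hφ
  have hback : (fun z : ℝ × ℝ => 2 * (z.1 + z.2) * φ z) = fun z => χ z.1 * θ z.2 := by
    funext z
    by_cases hz : z ∈ U
    · have := hs0 z hz
      simp only [hφdef]
      field_simp
    · rw [hφ.eq_zero hz, mul_zero]
      exact (hψ.eq_zero hz).symm
  have hd : partialU (partialV fun z : ℝ × ℝ => χ z.1 * θ z.2)
      = fun z => deriv χ z.1 * deriv θ z.2 := by
    rw [partialV_tensor, partialU_tensor]
  have h1 := hp.integral_eq φ hφ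
  have h2 := hq.integral_eq φ hφ
  have e1 : ∫ z in U, (p z + q z) * φ z = (∫ z in U, p z * φ z) + ∫ z in U, q z * φ z := by
    rw [← integral_add (hφ.integrableOn_mul_of_locallyIntegrableOn hp.locallyIntegrable)
      (hφ.integrableOn_mul_of_locallyIntegrableOn hq.locallyIntegrable)]
    simp only [add_mul]
  have i0 : IntegrableOn (fun z => f z * (deriv χ z.1 * deriv θ z.2)) U := by
    have := hψ.partialV.partialU.integrableOn_mul hfi
    rwa [hd] at this
  have i1 := hφ.partialU.integrableOn_mul hfi
  have i2 := hφ.partialV.integrableOn_mul hfi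
  rw [hback, hd, e1] at h0
  have h3 : ∫ z in U, (f z * (deriv χ z.1 * deriv θ z.2) - f z * partialU φ z
      - f z * partialV φ z) = 0 := by
    refine (integral_sub (i0.sub i1) i2).trans ?_
    have h4 := integral_sub i0 i1
    simp only [Pi.sub_apply] at h4 ⊢
    rw [h4]
    linarith
  rw [← h3]
  refine setIntegral_congr_fun isOpen_charRectInt.measurableSet fun z hz => ?_
  have hz0 := hs0 z hz
  have dχ : HasDerivAt χ (deriv χ z.1) z.1 := (hχ.smooth.differentiable (by simp) _).hasDerivAt
  have dθ : HasDerivAt θ (deriv θ z.2) z.2 := (hθ.smooth.differentiable (by simp) _).hasDerivAt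
  have d1 : HasDerivAt (fun x => 2 * (x + z.2)) 2 z.1 :=
    (((hasDerivAt_id z.1).add_const z.2).const_mul 2).congr_deriv (by simp)
  have d2 : HasDerivAt (fun y => 2 * (z.1 + y)) 2 z.2 :=
    (((hasDerivAt_id z.2).const_add z.1).const_mul 2).congr_deriv (by simp)
  have hz2 : 2 * (z.1 + z.2) ≠ 0 := mul_ne_zero two_ne_zero hz0
  have pu : partialU φ z = _ := ((dχ.mul_const (θ z.2)).fun_mul (d1.fun_inv hz2)).deriv
  have pv : partialV φ z = _ := ((dθ.const_mul (χ z.1)).fun_mul (d2.fun_inv hz2)).deriv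
  rw [pu, pv]
  field_simp
  ring

/-- The Volterra equation satisfied by a continuous function which solves the essential field
equation weakly and vanishes on the initial characteristics. -/
theorem volterra_of_integral_tensor {f k : ℝ × ℝ → ℝ} (hu : u₀ < u₁) (hv : v₀ < v₁)
    (hf : ContinuousOn f (charRect u₀ v₀ u₁ v₁)) (hk : ContinuousOn k (charRect u₀ v₀ u₁ v₁))
    (hf0 : ∀ v ∈ Icc v₀ v₁, f (u₀, v) = 0) (hf0' : ∀ u ∈ Icc u₀ u₁, f (u, v₀) = 0)
    (h : ∀ χ θ, IsTestFunction (Ioo u₀ u₁) χ → IsTestFunction (Ioo v₀ v₁) θ →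
      ∫ z in charRectInt u₀ v₀ u₁ v₁, f z * (deriv χ z.1 * (deriv θ z.2 - k z * θ z.2)
        - χ z.1 * (k z * deriv θ z.2 - 4 * k z ^ 2 * θ z.2)) = 0) :
    ∀ u ∈ Icc u₀ u₁, ∀ v ∈ Icc v₀ v₁,
      f (u, v) = -(∫ x in u₀..u, k (x, v) * f (x, v)) - (∫ y in v₀..v, k (u, y) * f (u, y))
        - ∫ y in v₀..v, ∫ x in u₀..u, 4 * k (x, y) ^ 2 * f (x, y) := by
  intro u hu' v hv'
  have hu0 : u₀ ∈ Icc u₀ u₁ := ⟨le_rfl, hu.le⟩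
  have hkf : ContinuousOn (fun z => k z * f z) (charRect u₀ v₀ u₁ v₁) := hk.mul hf
  have hkkf : ContinuousOn (fun z => 4 * k z ^ 2 * f z) (charRect u₀ v₀ u₁ v₁) :=
    (continuousOn_const.mul (hk.pow 2)).mul hf
  have hslice : ∀ {G : ℝ × ℝ → ℝ}, ContinuousOn G (charRect u₀ v₀ u₁ v₁) → ∀ x ∈ Icc u₀ u₁,
      ContinuousOn (fun y => G (x, y)) (Icc v₀ v₁) := fun hG x hx =>
    hG.comp (by fun_prop) fun y hy => ⟨hx, hy⟩
  have hslice' : ∀ {G : ℝ × ℝ → ℝ}, ContinuousOn G (charRect u₀ v₀ u₁ v₁) → ∀ y ∈ Icc v₀ v₁,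
      IntervalIntegrable (fun x => G (x, y)) volume u₀ u := fun hG y hy =>
    ContinuousOn.intervalIntegrable (hG.comp (by fun_prop) fun x hx => by
      rw [uIcc_of_le hu'.1] at hx
      exact ⟨⟨hx.1, hx.2.trans hu'.2⟩, hy⟩)
  have hC : ContinuousOn (fun y => f (u, y) + ∫ x in u₀..u, k (x, y) * f (x, y)) (Icc v₀ v₁) :=
    (hslice hf u hu').add (continuousOn_intervalIntegral_left hkf hu')
  have hE : ContinuousOn (fun y => -(k (u, y) * f (u, y)
      + ∫ x in u₀..u, 4 * k (x, y) ^ 2 * f (x, y))) (Icc v₀ v₁) :=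
    ((hslice hkf u hu').add (continuousOn_intervalIntegral_left hkkf hu')).neg
  -- the du Bois-Reymond lemma in `u` for fixed `θ`, then in `v` for fixed `u`
  have hprim := isPrimitiveOn_of_integral_mul_deriv hv hC
    (ContinuousOn.intervalIntegrable (by rwa [uIcc_of_le hv.le])) (fun θ hθ => by
      have hθc : Continuous θ := hθ.smooth.continuous
      have hθc' : Continuous (deriv θ) := hθ.smooth.continuous_deriv (by simp)
      have hAc : ContinuousOn (fun z : ℝ × ℝ => f z * (deriv θ z.2 - k z * θ z.2))
          (charRect u₀ v₀ u₁ v₁) :=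
        hf.mul ((hθc'.comp continuous_snd).continuousOn.sub
          (hk.mul (hθc.comp continuous_snd).continuousOn))
      have hBc : ContinuousOn (fun z : ℝ × ℝ =>
          f z * (4 * k z ^ 2 * θ z.2 - k z * deriv θ z.2)) (charRect u₀ v₀ u₁ v₁) :=
        hf.mul (((continuousOn_const.mul (hk.pow 2)).mul (hθc.comp continuous_snd).continuousOn).sub
          (hk.mul (hθc'.comp continuous_snd).continuousOn))
      have hA := isPrimitiveOn_of_integral_mul_deriv hu (continuousOn_setIntegral hv.le hAc)
        (ContinuousOn.intervalIntegrable (by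
          rw [uIcc_of_le hu.le]
          exact continuousOn_setIntegral hv.le hBc)) (fun χ hχ => by
        have hχc : Continuous χ := hχ.smooth.continuous
        have hχc' : Continuous (deriv χ) := hχ.smooth.continuous_deriv (by simp)
        have i1 := integrableOn_charRectInt_of_continuousOn
          (hAc.mul (hχc'.comp continuous_fst).continuousOn)
        have i2 := integrableOn_charRectInt_of_continuousOn
          (hBc.mul (hχc.comp continuous_fst).continuousOn)
        have h1 := (integral_add i1 i2).symm.trans ((h χ θ hχ hθ).symm.trans
          (setIntegral_congr_fun isOpen_charRectInt.measurableSet fun z _ => by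
            simp only [Pi.mul_apply, Function.comp]
            ring)).symm
        rw [setIntegral_charRectInt i1, setIntegral_charRectInt i2] at h1
        simp only [Pi.mul_apply, Function.comp, integral_mul_const] at h1
        linarith)
      have hA' := hA.eq_add u hu'
      have hA0 : ∫ y in Ioo v₀ v₁, f (u₀, y) * (deriv θ y - k (u₀, y) * θ y) = 0 := by
        refine (setIntegral_congr_fun measurableSet_Ioo fun y hy => ?_).trans
          (integral_zero ℝ ℝ)
        simp only [hf0 y (Ioo_subset_Icc_self hy), zero_mul]
      have hswap : ∫ x in u₀..u, ∫ y in Ioo v₀ v₁,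
            f (x, y) * (4 * k (x, y) ^ 2 * θ y - k (x, y) * deriv θ y)
          = ∫ y in Ioo v₀ v₁, ∫ x in u₀..u,
            f (x, y) * (4 * k (x, y) ^ 2 * θ y - k (x, y) * deriv θ y) := by
        refine intervalIntegral_integral_swap ?_
        rw [Measure.prod_restrict, ← Measure.volume_eq_prod, uIoc_of_le hu'.1]
        exact (hBc.integrableOn_compact isCompact_charRect).mono_set
          (prod_mono (Ioc_subset_Icc_self.trans (Icc_subset_Icc_right hu'.2)) Ioo_subset_Icc_self)
      rw [hA0, zero_add, hswap] at hA'
      have hint : ∀ {G : ℝ → ℝ}, ContinuousOn G (Icc v₀ v₁) → IntegrableOn G (Ioo v₀ v₁) :=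
        fun hG => (hG.integrableOn_compact isCompact_Icc).mono_set Ioo_subset_Icc_self
      have j1 := hint (hC.mul hθc'.continuousOn)
      have j2 := hint (hE.mul hθc.continuousOn)
      have j3 := hint (hslice hAc u hu')
      have j4 := hint (continuousOn_intervalIntegral_left hBc hu')
      rw [eq_neg_iff_add_eq_zero]
      refine (integral_add j1 j2).symm.trans (Eq.trans ?_
        ((integral_sub j3 j4).trans (sub_eq_zero.2 hA')))
      refine setIntegral_congr_fun measurableSet_Ioo fun y hy => ?_
      have hy' := Ioo_subset_Icc_self hy
      have e : ∫ x in u₀..u, f (x, y) * (4 * k (x, y) ^ 2 * θ y - k (x, y) * deriv θ y)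
          = (∫ x in u₀..u, 4 * k (x, y) ^ 2 * f (x, y)) * θ y
            - (∫ x in u₀..u, k (x, y) * f (x, y)) * deriv θ y := by
        rw [← intervalIntegral.integral_mul_const, ← intervalIntegral.integral_mul_const,
          ← intervalIntegral.integral_sub ((hslice' hkkf y hy').mul_const _)
            ((hslice' hkf y hy').mul_const _)]
        congr 1
        funext x
        ring
      simp only [Pi.mul_apply]
      rw [e]
      ring)
  have key := hprim.eq_add v hv'
  have hz : ∫ x in u₀..u, k (x, v₀) * f (x, v₀) = 0 := by
    refine (intervalIntegral.integral_congr fun x hx => ?_).trans intervalIntegral.integral_zero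
    rw [uIcc_of_le hu'.1] at hx
    simp only [hf0' x ⟨hx.1, hx.2.trans hu'.2⟩, mul_zero]
  have hsub : uIcc v₀ v ⊆ Icc v₀ v₁ := by
    rw [uIcc_of_le hv'.1]
    exact Icc_subset_Icc_right hv'.2
  rw [hf0' u hu', hz, intervalIntegral.integral_neg, intervalIntegral.integral_add
    ((hslice hkf u hu').mono hsub).intervalIntegrable
    ((continuousOn_intervalIntegral_left hkkf hu').mono hsub).intervalIntegrable] at key
  linarith

/-- One integration gains a factor `1 / L` in an exponentially weighted bound. -/
theorem abs_integral_le_exp {a x N L : ℝ} {h : ℝ → ℝ} (hax : a ≤ x) (hN : 0 ≤ N) (hL : 0 < L)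
    (hh : ∀ t ∈ Icc a x, |h t| ≤ N * Real.exp (L * t)) :
    |∫ t in a..x, h t| ≤ N / L * Real.exp (L * x) := by
  have h1 : |∫ t in a..x, h t| ≤ ∫ t in a..x, N * Real.exp (L * t) := by
    exact intervalIntegral.norm_integral_le_of_norm_le hax (f := h)
      (g := fun t => N * Real.exp (L * t))
      (Filter.Eventually.of_forall fun t ht => hh t (Ioc_subset_Icc_self ht))
      (Continuous.intervalIntegrable (by fun_prop) _ _)
  have h2 : ∫ t in a..x, N * Real.exp (L * t)
      = N / L * Real.exp (L * x) - N / L * Real.exp (L * a) := by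
    rw [intervalIntegral.integral_eq_sub_of_hasDerivAt
      (f := fun t => N / L * Real.exp (L * t))]
    · intro t _
      have h3 : HasDerivAt (fun t : ℝ => L * t) L t :=
        ((hasDerivAt_id t).const_mul L).congr_deriv (by simp)
      exact (h3.exp.const_mul (N / L)).congr_deriv (by field_simp)
    · exact Continuous.intervalIntegrable (by fun_prop) _ _
  have h3 : 0 ≤ N / L * Real.exp (L * a) := by positivity
  linarith

/-- The homogeneous Volterra equation has only the trivial solution, by comparison with a large
exponential. -/
theorem eq_zero_of_volterra {f k : ℝ × ℝ → ℝ}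
    (hf : ContinuousOn f (charRect u₀ v₀ u₁ v₁)) (hk : ContinuousOn k (charRect u₀ v₀ u₁ v₁))
    (h : ∀ u ∈ Icc u₀ u₁, ∀ v ∈ Icc v₀ v₁,
      f (u, v) = -(∫ x in u₀..u, k (x, v) * f (x, v)) - (∫ y in v₀..v, k (u, y) * f (u, y))
        - ∫ y in v₀..v, ∫ x in u₀..u, 4 * k (x, y) ^ 2 * f (x, y)) :
    ∀ z ∈ charRect u₀ v₀ u₁ v₁, f z = 0 := by
  intro z₀ hz₀
  obtain ⟨C', hC'⟩ := isCompact_charRect.exists_bound_of_continuousOn hk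
  obtain ⟨C, hC, hkC⟩ : ∃ C > 0, ∀ z ∈ charRect u₀ v₀ u₁ v₁, |k z| ≤ C :=
    ⟨max C' 1, by positivity, fun z hz => (hC' z hz).trans (le_max_left _ _)⟩
  -- this rate makes the three integrals below at most `1/8`, `1/8` and `1/16` of the maximum
  set L := 8 * C with hL
  have hL0 : 0 < L := by positivity
  have hwc : ContinuousOn (fun z : ℝ × ℝ => |f z| * Real.exp (-(L * (z.1 + z.2))))
      (charRect u₀ v₀ u₁ v₁) := hf.abs.mul (Continuous.continuousOn (by fun_prop))
  obtain ⟨w, hw, hmax⟩ := isCompact_charRect.exists_isMaxOn ⟨z₀, hz₀⟩ hwc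
  set M := |f w| * Real.exp (-(L * (w.1 + w.2))) with hM
  have hM0 : 0 ≤ M := by positivity
  have hle : ∀ z ∈ charRect u₀ v₀ u₁ v₁, |f z| ≤ M * Real.exp (L * (z.1 + z.2)) := by
    intro z hz
    have h1 : |f z| * Real.exp (-(L * (z.1 + z.2))) ≤ M := hmax hz
    rwa [Real.exp_neg, ← div_eq_mul_inv, div_le_iff₀ (Real.exp_pos _)] at h1
  obtain ⟨u, v⟩ := w
  have hu : u ∈ Icc u₀ u₁ := hw.1
  have hv : v ∈ Icc v₀ v₁ := hw.2
  have hin : ∀ x ∈ Icc u₀ u, x ∈ Icc u₀ u₁ := fun x hx => ⟨hx.1, hx.2.trans hu.2⟩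
  have hin' : ∀ y ∈ Icc v₀ v, y ∈ Icc v₀ v₁ := fun y hy => ⟨hy.1, hy.2.trans hv.2⟩
  have hexp : ∀ x y, Real.exp (L * (x + y)) = Real.exp (L * x) * Real.exp (L * y) := by
    intro x y
    rw [mul_add, Real.exp_add]
  have e1 : |∫ x in u₀..u, k (x, v) * f (x, v)|
      ≤ C * M * Real.exp (L * v) / L * Real.exp (L * u) := by
    refine abs_integral_le_exp hu.1 (by positivity) hL0 fun x hx => ?_
    have hz : (x, v) ∈ charRect u₀ v₀ u₁ v₁ := ⟨hin x hx, hv⟩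
    rw [abs_mul]
    calc _ ≤ C * (M * Real.exp (L * (x + v))) :=
          mul_le_mul (hkC _ hz) (hle _ hz) (abs_nonneg _) hC.le
      _ = _ := by rw [hexp]; ring
  have e2 : |∫ y in v₀..v, k (u, y) * f (u, y)|
      ≤ C * M * Real.exp (L * u) / L * Real.exp (L * v) := by
    refine abs_integral_le_exp hv.1 (by positivity) hL0 fun y hy => ?_
    have hz : (u, y) ∈ charRect u₀ v₀ u₁ v₁ := ⟨hu, hin' y hy⟩
    rw [abs_mul]
    calc _ ≤ C * (M * Real.exp (L * (u + y))) :=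
          mul_le_mul (hkC _ hz) (hle _ hz) (abs_nonneg _) hC.le
      _ = _ := by rw [hexp]; ring
  have e3 : |∫ y in v₀..v, ∫ x in u₀..u, 4 * k (x, y) ^ 2 * f (x, y)|
      ≤ 4 * C ^ 2 * M / L * Real.exp (L * u) / L * Real.exp (L * v) := by
    refine abs_integral_le_exp hv.1 (by positivity) hL0 fun y hy => ?_
    have h1 : |∫ x in u₀..u, 4 * k (x, y) ^ 2 * f (x, y)|
        ≤ 4 * C ^ 2 * M * Real.exp (L * y) / L * Real.exp (L * u) := by
      refine abs_integral_le_exp hu.1 (by positivity) hL0 fun x hx => ?_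
      have hz : (x, y) ∈ charRect u₀ v₀ u₁ v₁ := ⟨hin x hx, hin' y hy⟩
      have hk2 : k (x, y) ^ 2 ≤ C ^ 2 := sq_le_sq.2 ((hkC _ hz).trans (le_abs_self _))
      rw [abs_mul, abs_of_nonneg (by positivity : 0 ≤ 4 * k (x, y) ^ 2)]
      calc _ ≤ 4 * C ^ 2 * (M * Real.exp (L * (x + y))) :=
            mul_le_mul (by linarith) (hle _ hz) (abs_nonneg _) (by positivity)
        _ = _ := by rw [hexp]; ring
    exact h1.trans_eq (by ring)
  have hMf : |f (u, v)| = M * (Real.exp (L * u) * Real.exp (L * v)) := by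
    rw [hM, ← hexp, mul_assoc, ← Real.exp_add]
    simp
  set X := Real.exp (L * u) * Real.exp (L * v) with hX
  have hX0 : 0 < X := by positivity
  have htri : |f (u, v)| ≤ |∫ x in u₀..u, k (x, v) * f (x, v)|
      + |∫ y in v₀..v, k (u, y) * f (u, y)|
      + |∫ y in v₀..v, ∫ x in u₀..u, 4 * k (x, y) ^ 2 * f (x, y)| := by
    rw [h u hu v hv]
    refine (abs_sub _ _).trans (add_le_add_left ((abs_sub _ _).trans ?_) _)
    rw [abs_neg]
  have hfin : M * X ≤ (1 / 8 + 1 / 8 + 1 / 16) * (M * X) := by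
    rw [hMf] at htri
    refine htri.trans ((add_le_add (add_le_add e1 e2) e3).trans_eq ?_)
    clear_value M
    rw [hX, hL]
    field_simp
    ring
  have hM00 : M = 0 := by nlinarith [mul_nonneg hM0 hX0.le]
  have := hle z₀ hz₀
  rw [hM00, zero_mul] at this
  exact abs_eq_zero.1 (le_antisymm this (abs_nonneg _))

end Uniqueness

/-! ### Uniqueness of the spacetime -/

section Uniqueness

variable {u₀ v₀ u₁ v₁ : ℝ}

/-- A continuous weak solution of the essential field equation is determined by its values on the
initial characteristics. -/
theorem EssentialEqDistr.eqOn {f p q f' p' q' : ℝ × ℝ → ℝ} (hu : u₀ < u₁) (hv : v₀ < v₁)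
    (hsing : ∀ p ∈ charRect u₀ v₀ u₁ v₁, p.1 + p.2 ≠ 0)
    (hf : ContinuousOn f (charRect u₀ v₀ u₁ v₁)) (hf' : ContinuousOn f' (charRect u₀ v₀ u₁ v₁))
    (h : EssentialEqDistr (charRectInt u₀ v₀ u₁ v₁) f p q)
    (h' : EssentialEqDistr (charRectInt u₀ v₀ u₁ v₁) f' p' q')
    (hp : IsWeakPartialU (charRectInt u₀ v₀ u₁ v₁) f p)
    (hq : IsWeakPartialV (charRectInt u₀ v₀ u₁ v₁) f q)
    (hp' : IsWeakPartialU (charRectInt u₀ v₀ u₁ v₁) f' p')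
    (hq' : IsWeakPartialV (charRectInt u₀ v₀ u₁ v₁) f' q')
    (hU : ∀ u ∈ Icc u₀ u₁, f (u, v₀) = f' (u, v₀))
    (hV : ∀ v ∈ Icc v₀ v₁, f (u₀, v) = f' (u₀, v)) :
    EqOn f f' (charRect u₀ v₀ u₁ v₁) := by
  have hk : ContinuousOn (fun z : ℝ × ℝ => (2 * (z.1 + z.2))⁻¹) (charRect u₀ v₀ u₁ v₁) :=
    ContinuousOn.inv₀ (by fun_prop) fun z hz => mul_ne_zero two_ne_zero (hsing z hz)
  have key := eq_zero_of_volterra (hf.sub hf') hk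
    (volterra_of_integral_tensor hu hv (hf.sub hf') hk (fun v hv' => sub_eq_zero.2 (hV v hv'))
      (fun u hu' => sub_eq_zero.2 (hU u hu')) fun χ θ hχ hθ => ?_)
  · exact fun z hz => sub_eq_zero.1 (key z hz)
  have e := h.integral_tensor hsing hf hp hq hχ hθ
  have e' := h'.integral_tensor hsing hf' hp' hq' hχ hθ
  have hχc : Continuous χ := hχ.smooth.continuous
  have hχc' : Continuous (deriv χ) := hχ.smooth.continuous_deriv (by simp)
  have hθc : Continuous θ := hθ.smooth.continuous
  have hθc' : Continuous (deriv θ) := hθ.smooth.continuous_deriv (by simp)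
  have hw : ContinuousOn (fun z : ℝ × ℝ =>
      deriv χ z.1 * (deriv θ z.2 - (2 * (z.1 + z.2))⁻¹ * θ z.2)
        - χ z.1 * ((2 * (z.1 + z.2))⁻¹ * deriv θ z.2
          - 4 * ((2 * (z.1 + z.2))⁻¹) ^ 2 * θ z.2)) (charRect u₀ v₀ u₁ v₁) := by
    fun_prop
  have hsub := integral_sub (integrableOn_charRectInt_of_continuousOn (hf.mul hw))
    (integrableOn_charRectInt_of_continuousOn (hf'.mul hw))
  simp only [Pi.mul_apply] at hsub
  rw [e, e', sub_zero] at hsub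
  rw [← hsub]
  congr 1
  funext z
  simp only [Pi.sub_apply]
  ring

theorem setIntegral_mul_eq_of_eqOn {f f' : ℝ × ℝ → ℝ}
    (hff' : EqOn f f' (charRect u₀ v₀ u₁ v₁)) (w : ℝ × ℝ → ℝ) :
    ∫ z in charRectInt u₀ v₀ u₁ v₁, f z * w z = ∫ z in charRectInt u₀ v₀ u₁ v₁, f' z * w z :=
  setIntegral_congr_fun isOpen_charRectInt.measurableSet fun z hz => by
    simp only [hff' (charRectInt_subset hz)]

/-- Weak derivatives in `u` are unique almost everywhere. -/
theorem IsWeakPartialU.ae_eq {f f' p p' : ℝ × ℝ → ℝ}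
    (hp : IsWeakPartialU (charRectInt u₀ v₀ u₁ v₁) f p)
    (hp' : IsWeakPartialU (charRectInt u₀ v₀ u₁ v₁) f' p')
    (hff' : EqOn f f' (charRect u₀ v₀ u₁ v₁)) :
    ∀ᵐ z ∂volume.restrict (charRectInt u₀ v₀ u₁ v₁), p z = p' z :=
  ae_eq_of_setIntegral_mul_eq isOpen_charRectInt hp.locallyIntegrable hp'.locallyIntegrable
    fun φ hφ => by
      have h1 := hp.integral_eq φ hφ
      rw [setIntegral_mul_eq_of_eqOn hff', hp'.integral_eq φ hφ] at h1
      exact neg_inj.1 h1.symm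

/-- Weak derivatives in `v` are unique almost everywhere. -/
theorem IsWeakPartialV.ae_eq {f f' q q' : ℝ × ℝ → ℝ}
    (hq : IsWeakPartialV (charRectInt u₀ v₀ u₁ v₁) f q)
    (hq' : IsWeakPartialV (charRectInt u₀ v₀ u₁ v₁) f' q')
    (hff' : EqOn f f' (charRect u₀ v₀ u₁ v₁)) :
    ∀ᵐ z ∂volume.restrict (charRectInt u₀ v₀ u₁ v₁), q z = q' z :=
  ae_eq_of_setIntegral_mul_eq isOpen_charRectInt hq.locallyIntegrable hq'.locallyIntegrable
    fun φ hφ => by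
      have h1 := hq.integral_eq φ hφ
      rw [setIntegral_mul_eq_of_eqOn hff', hq'.integral_eq φ hφ] at h1
      exact neg_inj.1 h1.symm

/-- The constraint determines the distribution `a_x` from the almost everywhere classes of `c_x` and
`ψ_x`. -/
theorem ConstraintEqDistr.setIntegral_eq {κ : ℝ} {U : Set (ℝ × ℝ)}
    {ax cx ψx ax' cx' ψx' : ℝ × ℝ → ℝ} (h : ConstraintEqDistr κ U ax cx ψx)
    (h' : ConstraintEqDistr κ U ax' cx' ψx')
    (hc : ∀ᵐ z ∂volume.restrict U, cx z = cx' z) (hψ : ∀ᵐ z ∂volume.restrict U, ψx z = ψx' z)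
    {φ : ℝ × ℝ → ℝ} (hφ : IsTestFunction U φ) :
    ∫ z in U, ax z * φ z = ∫ z in U, ax' z * φ z := by
  rw [h φ hφ, h' φ hφ]
  refine integral_congr_ae ?_
  filter_upwards [hc, hψ] with z h1 h2
  rw [h1, h2]

theorem IsW12RegularSpacetime.eqOn {κ : ℝ} (hu : u₀ < u₁) (hv : v₀ < v₁)
    (hsing : ∀ p ∈ charRect u₀ v₀ u₁ v₁, p.1 + p.2 ≠ 0) {cN ψN cM ψM : ℝ → ℝ}
    {a b c ψ a' b' c' ψ' : ℝ × ℝ → ℝ}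
    (h : IsW12RegularSpacetime κ u₀ v₀ u₁ v₁ a b c ψ)
    (h' : IsW12RegularSpacetime κ u₀ v₀ u₁ v₁ a' b' c' ψ')
    (hd : AssumesCharData u₀ v₀ u₁ v₁ cN ψN cM ψM c ψ)
    (hd' : AssumesCharData u₀ v₀ u₁ v₁ cN ψN cM ψM c' ψ') :
    EqOn a a' (charRect u₀ v₀ u₁ v₁) ∧ EqOn b b' (charRect u₀ v₀ u₁ v₁) ∧
      EqOn c c' (charRect u₀ v₀ u₁ v₁) ∧ EqOn ψ ψ' (charRect u₀ v₀ u₁ v₁) := by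
  obtain ⟨au, av, cu, cv, ψu, ψv, hau, hav, hcu, hcv, hψu, hψv, -, -, hψe, hce, hCu, hCv⟩ :=
    h.weak_solution
  obtain ⟨au', av', cu', cv', ψu', ψv', hau', hav', hcu', hcv', hψu', hψv', -, -, hψe', hce',
    hCu', hCv'⟩ := h'.weak_solution
  have hc : EqOn c c' (charRect u₀ v₀ u₁ v₁) :=
    hce.eqOn hu hv hsing h.continuousOn_c h'.continuousOn_c hce' hcu hcv hcu' hcv'
      (fun u hu' => (hd.c_U u hu').trans (hd'.c_U u hu').symm)
      (fun v hv' => (hd.c_V v hv').trans (hd'.c_V v hv').symm)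
  have hψ : EqOn ψ ψ' (charRect u₀ v₀ u₁ v₁) :=
    hψe.eqOn hu hv hsing h.continuousOn_ψ h'.continuousOn_ψ hψe' hψu hψv hψu' hψv'
      (fun u hu' => (hd.ψ_U u hu').trans (hd'.ψ_U u hu').symm)
      (fun v hv' => (hd.ψ_V v hv').trans (hd'.ψ_V v hv').symm)
  refine ⟨fun z hz => ?_, fun z hz => (h.b_eq z hz).trans (h'.b_eq z hz).symm, hc, hψ⟩
  have hi := integrableOn_charRectInt_of_continuousOn h.continuousOn_a
  have hi' := integrableOn_charRectInt_of_continuousOn h'.continuousOn_a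
  have hconst := eq_corner_of_integral_mul_partial_eq_zero hu hv
    (h.continuousOn_a.sub h'.continuousOn_a) (fun φ hφ => by
      simp only [Pi.sub_apply, sub_mul]
      refine (integral_sub (hφ.partialU.integrableOn_mul hi)
        (hφ.partialU.integrableOn_mul hi')).trans ?_
      rw [hau.integral_eq φ hφ, hau'.integral_eq φ hφ,
        hCu.setIntegral_eq hCu' (hcu.ae_eq hcu' hc) (hψu.ae_eq hψu' hψ) hφ, sub_self])
    (fun φ hφ => by
      simp only [Pi.sub_apply, sub_mul]
      refine (integral_sub (hφ.partialV.integrableOn_mul hi)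
        (hφ.partialV.integrableOn_mul hi')).trans ?_
      rw [hav.integral_eq φ hφ, hav'.integral_eq φ hφ,
        hCv.setIntegral_eq hCv' (hcv.ae_eq hcv' hc) (hψv.ae_eq hψv' hψ) hφ, sub_self]) z hz
  simp only [Pi.sub_apply, h.normalization, h'.normalization, sub_self] at hconst
  exact sub_eq_zero.1 hconst

end Uniqueness

end

theorem theorem1 (κ : ℝ) (hκ : 0 < κ) (u₀ v₀ u₁ v₁ : ℝ) (hu : u₀ < u₁) (hv : v₀ < v₁)
    (hsing : ∀ p ∈ charRect u₀ v₀ u₁ v₁, p.1 + p.2 ≠ 0)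
    (cN ψN cM ψM : ℝ → ℝ)
    (hcN : IsCharData u₀ u₁ cN) (hψN : IsCharData u₀ u₁ ψN)
    (hcM : IsCharData v₀ v₁ cM) (hψM : IsCharData v₀ v₁ ψM)
    (hc : cN u₀ = cM v₀) (hψ : ψN u₀ = ψM v₀) :
    ∃ a b c ψ : ℝ × ℝ → ℝ,
      IsW12RegularSpacetime κ u₀ v₀ u₁ v₁ a b c ψ ∧
      AssumesCharData u₀ v₀ u₁ v₁ cN ψN cM ψM c ψ ∧
      ∀ a' b' c' ψ' : ℝ × ℝ → ℝ,
        IsW12RegularSpacetime κ u₀ v₀ u₁ v₁ a' b' c' ψ' →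
        AssumesCharData u₀ v₀ u₁ v₁ cN ψN cM ψM c' ψ' →
        EqOn a' a (charRect u₀ v₀ u₁ v₁) ∧ EqOn b' b (charRect u₀ v₀ u₁ v₁) ∧
        EqOn c' c (charRect u₀ v₀ u₁ v₁) ∧ EqOn ψ' ψ (charRect u₀ v₀ u₁ v₁) := by
  obtain ⟨a, b, c, ψ, h, hd⟩ :=
    exists_isW12RegularSpacetime hκ hu hv hsing hcN hψN hcM hψM hc hψ
  exact ⟨a, b, c, ψ, h, hd, fun a' b' c' ψ' h' hd' => h'.eqOn hu hv hsing h hd' hd⟩
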